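/- **Definitions.** Let $X$ be a proper geodesic metric space with basepoint $p$. *Morse geodesics.* A Morse gauge is a function $N:[1,\infty)\times[0,\infty)\to[0,\infty)$; gauges are ordered pointwise. A finite $(\lambda,\varepsilon)$–quasi-geodesic is a (not necessarily continuous) map $q$ from a compact interval to $X$ with $\frac1\lambda|s-t|-\varepsilon\le d(q(s),q(t))\le\lambda|s-t|+\varepsilon$. A geodesic satisfies the Morse condition for $N$ if every finite $(\lambda,\varepsilon)$–quasi-geodesic with endpoints on it lies in its $N(\lambda,\varepsilon)$–neighbourhood. A bi-infinite geodesic is called $N$–Morse if it and all its subgeodesics satisfy the Morse condition for $N$. *Morse boundary.* Let $\partial_vX_p$ be the set of geodesic rays from $p$, where rays at finite Hausdorff distance (asymptotic rays) are identified. A set $B\subseteq\partial_vX_p$ is closed iff it contains every $b$ for which there are rays $\beta_n$ from $p$ with $[\beta_n]\in B$ such that every subsequence of $(\beta_n)$ has a further subsequence converging uniformly on compact sets to a ray in $b$. Let $\partial^NX_p\subseteq\partial_vX_p$, with the subspace topology, be the set of classes of rays from $p$ satisfying the Morse condition for $N$. The Morse boundary $\partial X$ is $\bigcup_N\partial^NX_p$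 with the direct limit topology. A bi-infinite geodesic $\gamma$ is from $a$ to $b$ if $\gamma|_{(-\infty,0]}$ and $\gamma|_{[0,\infty)}$ are asymptotic to rays representing $a$ and $b$. *Centers.* Let $\partial X^{(n,N)}$ be the set of $n$–tuples of pairwise distinct points of $\partial X$ such that every bi-infinite geodesic between any two of them is $N$–Morse. For $(a,b,c)\in\partial X^{(3,N)}$ and $K>0$, let $m_X^{N,K}(a,b,c)$, the set of $K$–centers of $(a,b,c)$, be the set of points of $X$ within $K$ of all three sides of some geodesic triangle with vertices $a,b,c$. $X$ is an $N$–Morse center space if for some $K>0$ every point of $X$ lies in $m_X^{N,K}(V)$ for some $V\in\partial X^{(3,N)}$; it is a Morse center space if this holds for some $N$. *Cross-ratios.* For each gauge $N$ fix any constant $K_N>0$ such that on the sides of every ideal geodesic triangle with $N$–Morse sides there are three points, one on each side, pairwise at distance at most $K_N$ (such a constant exists). For $(a,b,c,d)\in\partial X^{(4,N)}$ put $$[a,b,c,d]_N=\operatorname{diam}\bigl(m_X^{N,K_N}(a,b,c)\cup m_X^{N,K_N}(a,d,c)\bigr).$$ $X$ has the small cross-ratio property if for each $N$ there is $C>0$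 such that for all $(a,b,c,d)\in\partial X^{(4,N)}$ at least one of $[a,b,c,d]_N$, $[a,c,b,d]_N$, $[b,a,c,d]_N$ is less than $C$. *Maps.* Let $Y$ be another proper geodesic metric space, with basepoint $r$. A map $h:\partial X\to\partial Y$ is 2–stable if for every $N$ there is $N'$ with $h(\partial X^{(2,N)})\subseteq\partial Y^{(2,N')}$. A 2–stable $h$ is quasi-möbius if for all gauges $N,N'$ with $h(\partial X^{(2,N)})\subseteq\partial Y^{(2,N')}$ there is a continuous increasing $\psi:[0,\infty)\to[0,\infty)$ such that $[h(a),h(b),h(c),h(d)]_{N'}\le\psi([a,b,c,d]_N)$ for all $(a,b,c,d)\in\partial X^{(4,N)}$. A map $f:X\to Y$ is a quasi-isometry if for some $\lambda\ge1$, $\varepsilon\ge0$ one has $\frac1\lambda d(x,x')-\varepsilon\le d(f(x),f(x'))\le\lambda d(x,x')+\varepsilon$ for all $x,x'\in X$, and there are $g:Y\to X$ and $D\ge0$ with $d(g(f(x)),x)\le D$ and $d(f(g(y)),y)\le D$ for all $x\in X$, $y\in Y$. **Theorem 4.2.** Let $X$ and $Y$ be proper geodesic metric spaces with basepoints $p$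 and $r$ that are Morse center spaces with the small cross-ratio property. Let $h:\partial X\to\partial Y$ be a homeomorphism such that $h$ and $h^{-1}$ are 2–stable and quasi-möbius. Then there are gauges $N\le N_h$ such that $(*)$ $X$ and $Y$ are both $N$–Morse center spaces and $h(\partial X^{(3,N)})\subseteq\partial Y^{(3,N_h)}$. Moreover, for any gauges $N\le N_h$ with $(*)$ there is $K_1>0$ such that for every $K\ge K_1$ the following holds. There is a map $f_K:X\to Y$ with $f_K(p)=r$ such that for every $x\ne p$ there is $(a,b,c)\in\partial X^{(3,N)}$ with $x\in m_X^{N,K}(a,b,c)$ and $f_K(x)\in m_Y^{N_h,K}(h(a),h(b),h(c))$; and every such map $f_K$ is a quasi-isometry. -/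

import Mathlib

open scoped NNReal

namespace MorseBdry

universe u v

/-! ### Coarse geometry -/

/-- A geodesic metric space: any two points are joined by a geodesic segment. -/
def IsGeodesicSpace (X : Type u) [MetricSpace X] : Prop :=
  ∀ x y : X, ∃ γ : ℝ → X, γ 0 = x ∧ γ (dist x y) = y ∧
    ∀ s ∈ Set.Icc 0 (dist x y), ∀ t ∈ Set.Icc 0 (dist x y), dist (γ s) (γ t) = |s - t|

/-- `f` is a quasi-isometry: for some `l ≥ 1` and `e ≥ 0` it is an `(l, e)`-quasi-isometric
embedding, and it has a quasi-inverse. -/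
def IsQuasiIsometry {X : Type u} {Y : Type v} [MetricSpace X] [MetricSpace Y] (f : X → Y) : Prop :=
  (∃ l e : ℝ, 1 ≤ l ∧ 0 ≤ e ∧
    ∀ x y : X, 1 / l * dist x y - e ≤ dist (f x) (f y) ∧ dist (f x) (f y) ≤ l * dist x y + e) ∧
  ∃ (g : Y → X) (D : ℝ), 0 ≤ D ∧ (∀ x, dist (g (f x)) x ≤ D) ∧ ∀ y, dist (f (g y)) y ≤ D

/-- A Morse gauge: a function `[1, ∞) × [0, ∞) → [0, ∞)`, with the pointwise order. -/
abbrev Gauge : Type := Set.Ici (1 : ℝ) → ℝ≥0 → ℝ≥0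

section Space

variable {X : Type u} [MetricSpace X]

/-- `q`, restricted to the compact interval `[s, t]`, is a finite `(l, e)`-quasi-geodesic. -/
def IsQuasiGeodesicOn (l : Set.Ici (1 : ℝ)) (e : ℝ≥0) (q : ℝ → X) (s t : ℝ) : Prop :=
  s ≤ t ∧ ∀ a ∈ Set.Icc s t, ∀ b ∈ Set.Icc s t,
    1 / (l : ℝ) * |a - b| - e ≤ dist (q a) (q b) ∧ dist (q a) (q b) ≤ l * |a - b| + e

/-- The Morse condition with gauge `N` for (the image `S` of) a geodesic: every finite
`(l, e)`-quasi-geodesic with endpoints on `S` lies in the (closed) `N(l, e)`-neighbourhood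
of `S`. -/
def IsMorseSet (N : Gauge) (S : Set X) : Prop :=
  ∀ (l : Set.Ici (1 : ℝ)) (e : ℝ≥0) (q : ℝ → X) (s t : ℝ), IsQuasiGeodesicOn l e q s t →
    q s ∈ S → q t ∈ S → ∀ w ∈ Set.Icc s t, ∃ y ∈ S, dist (q w) y ≤ N l e

/-- A bi-infinite geodesic `γ` is `N`-Morse: it and all its subgeodesics (its restrictions to
closed intervals, bounded or not) satisfy the Morse condition with gauge `N`. -/
def IsMorseLine (N : Gauge) (γ : ℝ → X) : Prop :=
  ∀ J : Set ℝ, J.OrdConnected → IsClosed J → IsMorseSet N (γ '' J)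

/-- Two (images of) rays are asymptotic: their Hausdorff distance is finite. -/
def Asymptotic (A B : Set X) : Prop := Metric.hausdorffEDist A B ≠ ⊤

/-- Geodesic rays based at `p`. -/
structure Ray (p : X) where
  toFun : ℝ≥0 → X
  isometry : Isometry toFun
  base : toFun 0 = p

/-- Two geodesic rays based at `p` are equivalent when they are asymptotic. -/
instance raySetoid (p : X) : Setoid (Ray p) where
  r α β := Asymptotic (Set.range α.toFun) (Set.range β.toFun)
  iseqv :=
    { refl := fun α => by simp [Asymptotic]
      symm := fun {α β} h => by
        unfold Asymptotic at h ⊢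
        rwa [Metric.hausdorffEDist_comm]
      trans := fun {α β γ} h₁ h₂ => by
        unfold Asymptotic at h₁ h₂ ⊢
        exact ne_top_of_le_ne_top (ENNReal.add_ne_top.2 ⟨h₁, h₂⟩)
          Metric.hausdorffEDist_triangle }

/-- The visual boundary based at `p`, as a set: equivalence classes of geodesic rays from `p`. -/
def VisualBoundary (p : X) : Type u := Quotient (raySetoid p)

/-- The class of a ray. -/
def Ray.cls {p : X} (α : Ray p) : VisualBoundary p := Quotient.mk (raySetoid p) α

/-- Uniform convergence on compact sets of a sequence of rays. -/
def RayTendsto {p : X} (β : ℕ → Ray p) (α : Ray p) : Prop :=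
  ∀ C : Set ℝ≥0, IsCompact C →
    TendstoUniformlyOn (fun n => (β n).toFun) α.toFun Filter.atTop C

/-- Every subsequence of `β` has a further subsequence that converges, uniformly on compact
sets, to a ray in the class `b`. -/
def SubConverges {p : X} (β : ℕ → Ray p) (b : VisualBoundary p) : Prop :=
  ∀ φ : ℕ → ℕ, StrictMono φ → ∃ ψ : ℕ → ℕ, StrictMono ψ ∧
    ∃ α : Ray p, α.cls = b ∧ RayTendsto (fun n => β (φ (ψ n))) α

theorem SubConverges.comp {p : X} {β : ℕ → Ray p} {b : VisualBoundary p}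
    (h : SubConverges β b) {φ : ℕ → ℕ} (hφ : StrictMono φ) :
    SubConverges (fun n => β (φ n)) b :=
  fun χ hχ => h (fun n => φ (χ n)) (hφ.comp hχ)

/-- The closed subsets of the visual boundary. -/
def VisualClosed {p : X} (B : Set (VisualBoundary p)) : Prop :=
  ∀ (β : ℕ → Ray p) (b : VisualBoundary p),
    (∀ n, (β n).cls ∈ B) → SubConverges β b → b ∈ B

/-- The topology of the visual boundary. -/
instance (p : X) : TopologicalSpace (VisualBoundary p) :=
  TopologicalSpace.ofClosed {B | VisualClosed B}
    (fun β _ h _ => (h 0).elim)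
    (fun _ hA β b h hb B hB => hA hB β b (fun n => h n B hB) hb)
    (fun A hA B hB β b h hb => by
      by_cases hf : ∃ᶠ n in Filter.atTop, (β n).cls ∈ A
      · obtain ⟨φ, hφ, h'⟩ := Filter.extraction_of_frequently_atTop hf
        exact Or.inl (hA _ b h' (hb.comp hφ))
      · have hf' : ∀ᶠ n in Filter.atTop, (β n).cls ∈ B := by
          filter_upwards [Filter.not_frequently.1 hf] with n hn
          exact (h n).resolve_left hn
        obtain ⟨φ, hφ, h'⟩ := Filter.extraction_of_frequently_atTop hf'.frequently
        exact Or.inr (hB _ b h' (hb.comp hφ)))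

/-- The stratum of gauge `N`: classes represented by an `N`-Morse geodesic ray based at `p`. -/
def stratum (p : X) (N : Gauge) : Set (VisualBoundary p) :=
  {a | ∃ α : Ray p, α.cls = a ∧ IsMorseSet N (Set.range α.toFun)}

/-- The Morse boundary based at `p`, as a set: the union of the strata. -/
def MorseBoundary (p : X) : Type u := {a : VisualBoundary p // ∃ N, a ∈ stratum p N}

/-- The inclusion of a stratum into the Morse boundary. -/
def stratumIncl (p : X) (N : Gauge) (a : stratum p N) : MorseBoundary p := ⟨a.1, N, a.2⟩

/-- The direct limit topology: the finest topology for which all the inclusions of the strata,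
with their subspace topologies, are continuous (in Mathlib's order on topologies, finer is
smaller). -/
instance (p : X) : TopologicalSpace (MorseBoundary p) :=
  ⨆ N : Gauge, TopologicalSpace.coinduced (stratumIncl p N) inferInstance

/-- `γ` is a bi-infinite geodesic from `a` to `b`. -/
def IsGeodesicFromTo {p : X} (γ : ℝ → X) (a b : MorseBoundary p) : Prop :=
  Isometry γ ∧
  (∃ α : Ray p, α.cls = a.1 ∧ Asymptotic (γ '' Set.Iic 0) (Set.range α.toFun)) ∧
  (∃ β : Ray p, β.cls = b.1 ∧ Asymptotic (γ '' Set.Ici 0) (Set.range β.toFun))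

/-- The set of `n`-tuples of pairwise distinct points of the Morse boundary such that every
geodesic between any two points of the tuple is `N`-Morse. -/
def morseTuples (p : X) (n : ℕ) (N : Gauge) : Set (Fin n → MorseBoundary p) :=
  {v | Function.Injective v ∧
    ∀ i j, i ≠ j → ∀ γ : ℝ → X, IsGeodesicFromTo γ (v i) (v j) → IsMorseLine N γ}

/-- `T 0`, `T 1`, `T 2` are the sides of an ideal geodesic triangle with vertices
`v 0`, `v 1`, `v 2`. -/
def IsIdealTriangle {p : X} (v : Fin 3 → MorseBoundary p) (T : Fin 3 → ℝ → X) : Prop :=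
  IsGeodesicFromTo (T 0) (v 0) (v 1) ∧ IsGeodesicFromTo (T 1) (v 1) (v 2) ∧
    IsGeodesicFromTo (T 2) (v 2) (v 0)

/-- The set of `K`-centers of the triple `v`: the points within `K` of all sides of some
geodesic triangle with vertices `v`. The gauge enters only through the domain: `v` has to be
one of the triples of gauge `N`, and otherwise the set is empty. -/
def centers (p : X) (N : Gauge) (K : ℝ) (v : Fin 3 → MorseBoundary p) : Set X :=
  {x | v ∈ morseTuples p 3 N ∧
    ∃ T : Fin 3 → ℝ → X, IsIdealTriangle v T ∧ ∀ i, ∃ t : ℝ, dist x (T i t) ≤ K}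

/-- Every ideal geodesic triangle all of whose sides are `N`-Morse has a `K`-internal triple:
a point on each side, pairwise at distance at most `K`. -/
def IsInternalConstant (p : X) (N : Gauge) (K : ℝ) : Prop :=
  0 < K ∧ ∀ (v : Fin 3 → MorseBoundary p) (T : Fin 3 → ℝ → X),
    IsIdealTriangle v T → (∀ i, IsMorseLine N (T i)) →
    ∃ t : Fin 3 → ℝ, ∀ i j, dist (T i (t i)) (T j (t j)) ≤ K

/-- `κ` is a choice of the constants `K_N`: whenever some constant `K` has the property
`IsInternalConstant p N K`, the number `κ N` is such a constant. (That one exists for every `N`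
in a proper geodesic space is a fact, and is not part of this definition.) -/
def IsInternalConstantChoice (p : X) (κ : Gauge → ℝ) : Prop :=
  ∀ N : Gauge, (∃ K, IsInternalConstant p N K) → IsInternalConstant p N (κ N)

/-- The `N`-cross-ratio `[a, b, c, d]_N`, formed with the constants `κ N = K_N`. -/
noncomputable def crossRatio (p : X) (κ : Gauge → ℝ) (N : Gauge)
    (a b c d : MorseBoundary p) : ℝ≥0 :=
  ⟨Metric.diam (centers p N (κ N) ![a, b, c] ∪ centers p N (κ N) ![a, d, c]),
    Metric.diam_nonneg⟩

/-- The small cross-ratio property. -/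
def SmallCrossRatio (p : X) (κ : Gauge → ℝ) : Prop :=
  ∀ N : Gauge, ∃ C : ℝ≥0, 0 < C ∧ ∀ a b c d : MorseBoundary p,
    ![a, b, c, d] ∈ morseTuples p 4 N →
      crossRatio p κ N a b c d < C ∨ crossRatio p κ N a c b d < C ∨ crossRatio p κ N b a c d < C

/-- `X` is an `N`-Morse center space: for some `K`, every point is a `K`-center of some triple
of gauge `N`. -/
def IsMorseCenterWith (p : X) (N : Gauge) : Prop :=
  ∃ K : ℝ, 0 < K ∧ ⋃ v ∈ morseTuples p 3 N, centers p N K v = Set.univ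

/-- `X` is a Morse center space. -/
def IsMorseCenter (p : X) : Prop := ∃ N, IsMorseCenterWith p N

end Space

section Maps

variable {X : Type u} {Y : Type v} [MetricSpace X] [MetricSpace Y] {p : X} {r : Y}

/-- `h` maps the `n`-tuples of gauge `N` to `n`-tuples of gauge `N'`. -/
def MapsTuples (h : MorseBoundary p → MorseBoundary r) (n : ℕ) (N N' : Gauge) : Prop :=
  ∀ v ∈ morseTuples p n N, h ∘ v ∈ morseTuples r n N'

/-- `h` is `2`-stable. -/
def IsTwoStable (h : MorseBoundary p → MorseBoundary r) : Prop :=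
  ∀ N : Gauge, ∃ N' : Gauge, MapsTuples h 2 N N'

/-- `h` is quasi-möbius, for the cross-ratios formed with the constants `κX`, `κY`. -/
def IsQuasiMobius (κX κY : Gauge → ℝ) (h : MorseBoundary p → MorseBoundary r) : Prop :=
  ∀ N N' : Gauge, MapsTuples h 2 N N' →
    ∃ ψ : ℝ≥0 → ℝ≥0, Continuous ψ ∧ Monotone ψ ∧
      ∀ a b c d : MorseBoundary p, ![a, b, c, d] ∈ morseTuples p 4 N →
        crossRatio r κY N' (h a) (h b) (h c) (h d) ≤ ψ (crossRatio p κX N a b c d)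

/-- `f` is a map `f_K`, formed with the gauges `N` and `Nh`: it sends the basepoint `p` to the
basepoint `r`, and every other point `x` to a `K`-center of the image under `h` of a triple of
gauge `N` of which `x` is a `K`-center. -/
def IsCenterMap (h : MorseBoundary p → MorseBoundary r) (N Nh : Gauge) (K : ℝ) (f : X → Y) :
    Prop :=
  f p = r ∧ ∀ x, x ≠ p → ∃ v : Fin 3 → MorseBoundary p,
    x ∈ centers p N K v ∧ f x ∈ centers r Nh K (h ∘ v)

/-- The gauges `N` and `Nh` can be used to form the maps `f_K`: both spaces are `N`-Morse center
spaces, `N ≤ Nh`, and `h` maps the triples of gauge `N` to triples of gauge `Nh`. -/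
def AdmissibleGauges (h : MorseBoundary p → MorseBoundary r) (N Nh : Gauge) : Prop :=
  IsMorseCenterWith p N ∧ IsMorseCenterWith r N ∧ N ≤ Nh ∧ MapsTuples h 3 N Nh

end Maps

end MorseBdry

/-! Fix compatible gauges. A map of the required kind sends `x` to a center of the `h`-image of some
triple having `x` as a center. The crux, `exists_dist_map_centers_le`, is that the result is
coarsely independent of the triple: if two triples have nearby centers, so do their images. The two
triples are connected by exchanging one vertex at a time while `x` stays a center.

A single exchange of `a` for `a'` in `(a, b, c)` is `exists_dist_le_of_replace_vertex`. All centers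
of `(b, a, c)` and `(b, a', c)` are close to `x`, so the cross-ratio `[b, a, c, a']` is bounded; the
quasi-möbius inequality bounds the image cross-ratio, which dominates the displacement of the image
centers. Three facts about ideal Morse triangles make such exchanges possible. Centers form
uniformly bounded sets (`exists_dist_centers_le`). By thinness, a point near the side `ab` is near a
line from `a` or from `b` to any third point seen from it along a Morse line
(`NearPair.near_or_near`); this dictates which vertex to exchange. And two boundary points seen from
`x` along Morse lines are joined only by lines of controlled gauge (`NearPair.morsePair`), so the
mixed triples on the way have a uniform gauge, which 2-stability carries over to `Y`.

All of this rests on one construction: following a quasi-geodesic up to an almost nearest point to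
`z`, then a geodesic to `z`, gives a quasi-geodesic (`IsQuasiGeodesicOn.append`), to which Morse
conditions apply.

Applied to `h` and `h.symm`, the crux yields coarsely Lipschitz maps in both directions. They are
coarse inverses, since a point and its image share a triple up to `h`. -/

namespace MorseBdry

/-! ### Quasi-geodesics, concatenation and Morse sets -/

section Coarse

variable {X : Type*} [MetricSpace X]

/-- `x` is within `R` of some point of `S`. -/
def IsNear (R : ℝ) (x : X) (S : Set X) : Prop := ∃ y ∈ S, dist x y ≤ R

/-- `γ` restricts to a geodesic on `[i, j]`. -/
def GeodesicOn (γ : ℝ → X) (i j : ℝ) : Prop :=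
  ∀ s ∈ Set.Icc i j, ∀ t ∈ Set.Icc i j, dist (γ s) (γ t) = |s - t|

/-- The multiplicative constant `1`. -/
def scaleOne : Set.Ici (1 : ℝ) := ⟨1, Set.self_mem_Ici⟩

/-- Three times a multiplicative constant. -/
def scaleTriple (l : Set.Ici (1 : ℝ)) : Set.Ici (1 : ℝ) :=
  ⟨3 * l, by have : (1 : ℝ) ≤ l := l.2; simp only [Set.mem_Ici]; linarith⟩

theorem IsNear.mono {R R' : ℝ} {x : X} {S : Set X} (h : IsNear R x S) (hR : R ≤ R') :
    IsNear R' x S :=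
  let ⟨y, hy, hd⟩ := h; ⟨y, hy, hd.trans hR⟩

theorem IsNear.of_dist {R K : ℝ} {x x' : X} {S : Set X} (h : IsNear R x S) (hd : dist x' x ≤ K) :
    IsNear (K + R) x' S :=
  let ⟨y, hy, hxy⟩ := h; ⟨y, hy, (dist_triangle _ _ _).trans (add_le_add hd hxy)⟩

theorem isometry_geodesicOn {γ : ℝ → X} (h : Isometry γ) (i j : ℝ) : GeodesicOn γ i j :=
  fun s _ t _ => by rw [h.dist_eq, Real.dist_eq]

theorem GeodesicOn.mono {γ : ℝ → X} {i j i' j' : ℝ} (h : GeodesicOn γ i j) (hi : i ≤ i')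
    (hj : j' ≤ j) : GeodesicOn γ i' j' :=
  fun s hs t ht => h s ⟨hi.trans hs.1, hs.2.trans hj⟩ t ⟨hi.trans ht.1, ht.2.trans hj⟩

theorem GeodesicOn.reverse {γ : ℝ → X} {i j : ℝ} (h : GeodesicOn γ i j) :
    GeodesicOn (fun r => γ (-r)) (-j) (-i) := by
  intro s hs t ht
  rw [h (-s) ⟨by linarith [hs.2], by linarith [hs.1]⟩ (-t) ⟨by linarith [ht.2], by linarith [ht.1]⟩,
    ← abs_neg]
  congr 1; ring

theorem GeodesicOn.isQuasiGeodesicOn {γ : ℝ → X} {i j : ℝ} (h : GeodesicOn γ i j) (hij : i ≤ j) :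
    IsQuasiGeodesicOn scaleOne 0 γ i j := by
  refine ⟨hij, fun a ha b hb => ?_⟩
  rw [h a ha b hb]
  simp [scaleOne]

theorem IsQuasiGeodesicOn.reverse {l : Set.Ici (1 : ℝ)} {e : ℝ≥0} {q : ℝ → X} {s t : ℝ}
    (h : IsQuasiGeodesicOn l e q s t) :
    IsQuasiGeodesicOn l e (fun r => q (-r)) (-t) (-s) := by
  refine ⟨by linarith [h.1], fun a ha b hb => ?_⟩
  have := h.2 (-a) ⟨by linarith [ha.2], by linarith [ha.1]⟩ (-b)
    ⟨by linarith [hb.2], by linarith [hb.1]⟩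
  have e1 : |(-a) - (-b)| = |a - b| := by rw [← abs_neg]; congr 1; ring
  rwa [e1] at this

theorem IsQuasiGeodesicOn.mono {l : Set.Ici (1 : ℝ)} {e : ℝ≥0} {q : ℝ → X} {s t s' t' : ℝ}
    (h : IsQuasiGeodesicOn l e q s t) (hs : s ≤ s') (ht : t' ≤ t) (hst : s' ≤ t') :
    IsQuasiGeodesicOn l e q s' t' :=
  ⟨hst, fun a ha b hb => h.2 a ⟨hs.trans ha.1, ha.2.trans ht⟩ b ⟨hs.trans hb.1, hb.2.trans ht⟩⟩

/-- It suffices to check the inequalities for ordered pairs of parameters. -/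
theorem IsQuasiGeodesicOn.of_le {l : Set.Ici (1 : ℝ)} {e : ℝ≥0} {q : ℝ → X} {s t : ℝ}
    (hst : s ≤ t) (h : ∀ a b, s ≤ a → a ≤ b → b ≤ t →
      1 / (l : ℝ) * (b - a) - e ≤ dist (q a) (q b) ∧ dist (q a) (q b) ≤ l * (b - a) + e) :
    IsQuasiGeodesicOn l e q s t := by
  refine ⟨hst, fun a ha b hb => ?_⟩
  rcases le_total a b with hab | hab
  · rw [abs_sub_comm, abs_of_nonneg (sub_nonneg.2 hab)]
    exact h a b ha.1 hab hb.2
  · rw [abs_of_nonneg (sub_nonneg.2 hab), dist_comm]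
    exact h b a hb.1 hab ha.2

/-- Moving the points of a quasi-geodesic by at most `C` yields a quasi-geodesic. -/
theorem IsQuasiGeodesicOn.perturb {l : Set.Ici (1 : ℝ)} {e C : ℝ≥0} {q q' : ℝ → X} {s t : ℝ}
    (h : IsQuasiGeodesicOn l e q s t) (hq : ∀ r, dist (q' r) (q r) ≤ C) :
    IsQuasiGeodesicOn l (e + 2 * C) q' s t := by
  refine ⟨h.1, fun a ha b hb => ?_⟩
  obtain ⟨h1, h2⟩ := h.2 a ha b hb
  have e1 : dist (q a) (q b) ≤ dist (q' a) (q a) + dist (q' a) (q' b) + dist (q' b) (q b) := by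
    have := dist_triangle4 (q a) (q' a) (q' b) (q b)
    rwa [dist_comm (q a) (q' a)] at this
  have e2 : dist (q' a) (q' b) ≤ dist (q' a) (q a) + dist (q a) (q b) + dist (q' b) (q b) := by
    have := dist_triangle4 (q' a) (q a) (q b) (q' b)
    rwa [dist_comm (q b) (q' b)] at this
  have := hq a
  have := hq b
  push_cast
  constructor <;> linarith

/-- A quasi-geodesic with endpoints near a Morse set stays near it. -/
theorem IsMorseSet.isNear_of_endpoints {N : Gauge} {S : Set X} (hS : IsMorseSet N S)
    {l : Set.Ici (1 : ℝ)} {e C : ℝ≥0} {q : ℝ → X} {s t : ℝ} (h : IsQuasiGeodesicOn l e q s t)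
    (hs : IsNear C (q s) S) (ht : IsNear C (q t) S) :
    ∀ w ∈ Set.Icc s t, IsNear (max C (N l (e + 2 * C)) : ℝ≥0) (q w) S := by
  intro w hw
  by_cases hws : w = s
  · rw [hws]; exact hs.mono (NNReal.coe_le_coe.2 (le_max_left _ _))
  by_cases hwt : w = t
  · rw [hwt]; exact ht.mono (NNReal.coe_le_coe.2 (le_max_left _ _))
  -- The endpoints are moved onto `S` by two updates, which must not overwrite each other.
  have hst : s ≠ t := fun h' => hws (le_antisymm (h' ▸ hw.2) hw.1)
  obtain ⟨x, hx, hdx⟩ := hs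
  obtain ⟨y, hy, hdy⟩ := ht
  have hq : ∀ r, dist (Function.update (Function.update q s x) t y r) (q r) ≤ C := by
    intro r
    by_cases hrt : r = t
    · subst hrt; simpa [dist_comm] using hdy
    by_cases hrs : r = s
    · subst hrs; simpa [hrt, dist_comm] using hdx
    · simp [hrt, hrs]
  obtain ⟨z, hz, hd⟩ := hS l _ _ s t (h.perturb hq) (by simpa [hst] using hx) (by simpa using hy)
    w hw
  refine IsNear.mono ⟨z, hz, ?_⟩ (NNReal.coe_le_coe.2 (le_max_right _ _))
  simpa [hws, hwt] using hd

/-- Quasi-geodesics need not be continuous, so the infimum of the distances to `z` may not be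
attained; the slack `1` replaces compactness. -/
theorem exists_almost_nearest (q : ℝ → X) {s t : ℝ} (hst : s ≤ t) (z : X) :
    ∃ m ∈ Set.Icc s t, ∀ r ∈ Set.Icc s t, dist (q m) z ≤ dist (q r) z + 1 := by
  set A : Set ℝ := (fun r => dist (q r) z) '' Set.Icc s t
  have hA : A.Nonempty := ⟨_, s, ⟨le_refl _, hst⟩, rfl⟩
  have hb : BddBelow A := ⟨0, by rintro _ ⟨r, _, rfl⟩; exact dist_nonneg⟩
  obtain ⟨_, ⟨m, hm, rfl⟩, hlt⟩ := exists_lt_of_csInf_lt hA (lt_add_one (sInf A))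
  exact ⟨m, hm, fun r hr => by
    have := csInf_le hb (Set.mem_image_of_mem (fun r => dist (q r) z) hr)
    linarith⟩

/-- Appending to a quasi-geodesic a geodesic from its endpoint to a point to which this endpoint
is almost nearest. -/
theorem IsQuasiGeodesicOn.append (hX : IsGeodesicSpace X) {l : Set.Ici (1 : ℝ)} {e : ℝ≥0}
    {q : ℝ → X} {s m : ℝ} (h : IsQuasiGeodesicOn l e q s m) (z : X)
    (hz : ∀ r ∈ Set.Icc s m, dist (q m) z ≤ dist (q r) z + 1) :
    ∃ (q' : ℝ → X) (L : ℝ), 0 ≤ L ∧ (∀ r ≤ m, q' r = q r) ∧ q' (m + L) = z ∧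
      IsQuasiGeodesicOn (scaleTriple l) (e + 1) q' s (m + L) := by
  obtain ⟨σ, hσ0, hσ1, hσ⟩ := hX (q m) z
  set L := dist (q m) z
  have hL : 0 ≤ L := dist_nonneg
  have hl : (1 : ℝ) ≤ l := l.2
  have he : (0 : ℝ) ≤ e := e.2
  have hcoe : ((scaleTriple l : Set.Ici (1 : ℝ)) : ℝ) = 3 * l := rfl
  have hlow : ∀ D x : ℝ, x ≤ 3 * l * (D + (e + 1)) → 1 / (3 * (l : ℝ)) * x - (e + 1) ≤ D := by
    intro D x hx
    have : 1 / (3 * (l : ℝ)) * x ≤ 1 / (3 * (l : ℝ)) * (3 * l * (D + (e + 1))) :=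
      mul_le_mul_of_nonneg_left hx (by positivity)
    have e2 : 1 / (3 * (l : ℝ)) * (3 * l * (D + (e + 1))) = D + (e + 1) := by
      field_simp
    linarith
  refine ⟨fun r => if r ≤ m then q r else σ (r - m), L, hL, fun r hr => if_pos hr, ?_, ?_⟩
  · by_cases h0 : L = 0
    · simp only [h0, add_zero, le_refl, if_true]
      exact dist_eq_zero.1 h0
    · have : ¬ (m + L ≤ m) := by
        have := lt_of_le_of_ne hL (Ne.symm h0); linarith
      simp only [this, if_false, add_sub_cancel_left]
      exact hσ1
  · refine IsQuasiGeodesicOn.of_le (by linarith [h.1]) fun a b ha hab hb => ?_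
    rw [hcoe]
    push_cast
    by_cases hbm : b ≤ m
    · have ham := hab.trans hbm
      simp only [ham, hbm, if_true]
      obtain ⟨h1, h2⟩ := h.2 a ⟨ha, ham⟩ b ⟨ha.trans hab, hbm⟩
      rw [abs_sub_comm, abs_of_nonneg (sub_nonneg.2 hab)] at h1 h2
      have hD := @dist_nonneg _ _ (q a) (q b)
      constructor
      · apply hlow
        have : (l : ℝ) * (1 / l * (b - a) - e) ≤ l * dist (q a) (q b) :=
          mul_le_mul_of_nonneg_left h1 (by linarith)
        have e3 : (l : ℝ) * (1 / l * (b - a) - e) = (b - a) - l * e := by field_simp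
        nlinarith
      · nlinarith
    · by_cases ham : a ≤ m
      · simp only [ham, hbm, if_true, if_false]
        push Not at hbm
        set u := b - m with hu
        have hu0 : 0 ≤ u := by linarith
        have huL : u ≤ L := by linarith
        obtain ⟨h1, h2⟩ := h.2 a ⟨ha, ham⟩ m ⟨ha.trans ham, le_refl _⟩
        rw [abs_sub_comm, abs_of_nonneg (sub_nonneg.2 ham)] at h1 h2
        have d1 : dist (q m) (σ u) = u := by
          rw [← hσ0, hσ 0 ⟨le_refl _, hL⟩ u ⟨hu0, huL⟩, zero_sub, abs_neg, abs_of_nonneg hu0]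
        have d2 : dist (σ u) z = L - u := by
          rw [← hσ1, hσ u ⟨hu0, huL⟩ L ⟨hL, le_refl _⟩, abs_sub_comm, abs_of_nonneg (by linarith)]
        have d3 := hz a ⟨ha, ham⟩
        have t1 := dist_triangle (q a) (σ u) z
        have t2 := dist_triangle (q a) (σ u) (q m)
        rw [dist_comm (σ u) (q m)] at t2
        have t3 := dist_triangle (q a) (q m) (σ u)
        have hD := @dist_nonneg _ _ (q a) (σ u)
        -- Almost-minimality enters here: reaching `z` from `q a` through `σ u` cannot be shorter
        -- than `L - 1`. Both pieces of the path are then bounded by the distance of their far ends,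
        -- whence the factor `3`.
        have huD : u ≤ dist (q a) (σ u) + 1 := by linarith
        constructor
        · apply hlow
          have : (l : ℝ) * (1 / l * (m - a) - e) ≤ l * dist (q a) (q m) :=
            mul_le_mul_of_nonneg_left h1 (by linarith)
          have e3 : (l : ℝ) * (1 / l * (m - a) - e) = (m - a) - l * e := by field_simp
          have e4 : (l : ℝ) * dist (q a) (q m) ≤ l * (2 * dist (q a) (σ u) + 1) :=
            mul_le_mul_of_nonneg_left (by linarith) (by linarith)
          have e5 : b - a = (m - a) + u := by ring
          nlinarith
        · have e5 : b - a = (m - a) + u := by ring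
          rw [e5]
          nlinarith
      · simp only [ham, hbm, if_false]
        push Not at ham hbm
        rw [hσ (a - m) ⟨by linarith, by linarith⟩ (b - m) ⟨by linarith, by linarith⟩]
        have : |a - m - (b - m)| = b - a := by
          rw [abs_sub_comm, abs_of_nonneg (by linarith)]; ring
        rw [this]
        constructor
        · apply hlow
          nlinarith
        · nlinarith

/-- The version of `IsQuasiGeodesicOn.append` for the initial endpoint. -/
theorem IsQuasiGeodesicOn.prepend (hX : IsGeodesicSpace X) {l : Set.Ici (1 : ℝ)} {e : ℝ≥0}
    {q : ℝ → X} {m t : ℝ} (h : IsQuasiGeodesicOn l e q m t) (z : X)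
    (hz : ∀ r ∈ Set.Icc m t, dist (q m) z ≤ dist (q r) z + 1) :
    ∃ (q' : ℝ → X) (L : ℝ), 0 ≤ L ∧ (∀ r, m ≤ r → q' r = q r) ∧ q' (m - L) = z ∧
      IsQuasiGeodesicOn (scaleTriple l) (e + 1) q' (m - L) t := by
  obtain ⟨q', L, hL, hq', hz', hqg⟩ := h.reverse.append hX z (fun r hr => by
    simpa using hz (-r) ⟨by linarith [hr.2], by linarith [hr.1]⟩)
  refine ⟨fun r => q' (-r), L, hL, fun r hr => ?_, ?_, ?_⟩
  · change q' (-r) = q r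
    rw [hq' (-r) (by linarith), neg_neg]
  · change q' (-(m - L)) = z
    rw [← hz']; congr 1; ring
  · have := hqg.reverse
    rwa [neg_neg, show -(-m + L) = m - L by ring] at this

/-- The constant in `exists_thin_corner`. -/
noncomputable def thinConst (N : Gauge) (R : ℝ≥0) : ℝ≥0 :=
  max R (N (scaleTriple scaleOne) (0 + 1 + 2 * R))

/-- Continuing `γ` by a geodesic from `γ w` to `o` gives a quasi-geodesic with both endpoints near
`S`. -/
theorem IsMorseSet.isNear_of_almost_nearest (hX : IsGeodesicSpace X) {N : Gauge} {S : Set X}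
    (hS : IsMorseSet N S) {R : ℝ≥0} {o : X} (ho : IsNear R o S) {γ : ℝ → X} {i w : ℝ}
    (hiw : i ≤ w) (hγ : GeodesicOn γ i w) (hi : IsNear R (γ i) S)
    (hw : ∀ r ∈ Set.Icc i w, dist (γ w) o ≤ dist (γ r) o + 1) :
    ∀ t ∈ Set.Icc i w, IsNear (thinConst N R) (γ t) S := by
  obtain ⟨q', L, hL, hq', hz, hqg⟩ := (hγ.isQuasiGeodesicOn hiw).append hX o hw
  intro t ht
  have := hS.isNear_of_endpoints hqg (C := R) (by rwa [hq' i hiw]) (by rwa [hz]) t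
    ⟨ht.1, by linarith [ht.2]⟩
  rwa [hq' t ht.2] at this

/-- A geodesic triangle two of whose sides are near Morse sets is thin: the third side breaks into
a part near the first and a part near the second side. -/
theorem exists_thin_corner (hX : IsGeodesicSpace X) {N : Gauge} {S₁ S₂ : Set X}
    (h₁ : IsMorseSet N S₁) (h₂ : IsMorseSet N S₂) {R : ℝ≥0} {o : X} (ho₁ : IsNear R o S₁)
    (ho₂ : IsNear R o S₂) {γ : ℝ → X} {i j : ℝ} (hij : i ≤ j) (hγ : GeodesicOn γ i j)
    (hi : IsNear R (γ i) S₁) (hj : IsNear R (γ j) S₂) :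
    ∃ w ∈ Set.Icc i j, (∀ t ∈ Set.Icc i w, IsNear (thinConst N R) (γ t) S₁) ∧
      ∀ t ∈ Set.Icc w j, IsNear (thinConst N R) (γ t) S₂ := by
  -- The break point is almost nearest to the corner `o`, so either half of `γ` can be continued to
  -- `o`.
  obtain ⟨w, hw, hmin⟩ := exists_almost_nearest γ hij o
  refine ⟨w, hw, ?_, fun t ht => ?_⟩
  · exact h₁.isNear_of_almost_nearest hX ho₁ hw.1 (hγ.mono le_rfl hw.2) hi
      fun r hr => hmin r ⟨hr.1, hr.2.trans hw.2⟩
  · have := h₂.isNear_of_almost_nearest hX ho₂ (γ := fun r => γ (-r)) (i := -j) (w := -w)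
      (by linarith [hw.2]) (hγ.mono hw.1 le_rfl).reverse (by simpa using hj)
      (fun r hr => by
        simpa using hmin (-r) ⟨by linarith [hr.2, hw.1], by linarith [hr.1]⟩)
      (-t) ⟨by linarith [ht.2], by linarith [ht.1]⟩
    simpa using this

/-- The constant in `exists_near_of_asymptotic`. -/
def endConst (N : Gauge) : ℝ≥0 := N (scaleTriple (scaleTriple scaleOne)) (0 + 1 + 1)

/-- Far out, a ray is uniformly near every Morse ray asymptotic to it. -/
theorem exists_near_of_asymptotic (hX : IsGeodesicSpace X) {N : Gauge} {α β : ℝ → X}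
    (hα : Isometry α) (hβ : Isometry β) (hN : IsMorseSet N (Set.range α)) {C : ℝ}
    (hC : ∀ t, 0 ≤ t → dist (α t) (β t) ≤ C) (M : ℝ) :
    ∃ T, ∀ t, T ≤ t → ∃ t', M ≤ t' ∧ dist (β t) (α t') ≤ endConst N := by
  have hC0 : 0 ≤ C := dist_nonneg.trans (hC 0 le_rfl)
  set R : ℝ := (endConst N : ℝ) with hR
  have hR0 : 0 ≤ R := (endConst N).2
  -- Only this threshold depends on `C`. The part `2 * C + 1` puts `t` beyond the first cut `m₁`;
  -- the part `|M| + C + R` forces `M ≤ t'`.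
  refine ⟨|M| + C + R + 2 * C + 1, fun t ht => ?_⟩
  have hM0 := abs_nonneg M
  have hM1 := le_abs_self M
  -- `β` on `[0, n]` is rerouted at both ends to start at `α 0` and end at `α n`. The second cut is
  -- within `3 * (2 * C + 2)` of `n`, so the part around `t` survives.
  set n := t + 6 * C + 6 with hn
  have hn0 : 0 ≤ n := by linarith
  obtain ⟨m₁, hm₁, hmin₁⟩ := exists_almost_nearest β hn0 (α 0)
  have hm₁' : m₁ ≤ 2 * C + 1 := by
    have e1 := hmin₁ 0 ⟨le_rfl, hn0⟩
    have e2 := hC 0 le_rfl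
    have e3 := dist_triangle (β m₁) (α 0) (β 0)
    rw [hβ.dist_eq, Real.dist_eq, sub_zero] at e3
    rw [dist_comm (β 0)] at e1
    linarith [le_abs_self m₁]
  obtain ⟨q₁, L₁, hL₁, hq₁, hz₁, hqg₁⟩ :=
    (((isometry_geodesicOn hβ 0 n).isQuasiGeodesicOn hn0).mono hm₁.1 le_rfl hm₁.2).prepend hX (α 0)
      (fun r hr => hmin₁ r ⟨hm₁.1.trans hr.1, hr.2⟩)
  obtain ⟨m₂, hm₂, hmin₂⟩ := exists_almost_nearest q₁ hqg₁.1 (α n)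
  have hm₂' : t ≤ m₂ := by
    have e1 := hmin₂ n ⟨hqg₁.1, le_rfl⟩
    have e2 := hC n hn0
    have e3 := dist_triangle (q₁ m₂) (α n) (q₁ n)
    have e4 := (hqg₁.2 m₂ hm₂ n ⟨hqg₁.1, le_rfl⟩).1
    have e5 : ((scaleTriple scaleOne : Set.Ici (1 : ℝ)) : ℝ) = 3 := by
      simp [scaleTriple, scaleOne]
    rw [e5] at e4
    push_cast at e4
    rw [hq₁ n hm₁.2] at e1 e3 e4
    rw [dist_comm (β n)] at e1
    rw [abs_sub_comm] at e4
    linarith [le_abs_self (n - m₂)]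
  obtain ⟨q₂, L₂, hL₂, hq₂, hz₂, hqg₂⟩ :=
    (hqg₁.mono le_rfl hm₂.2 hm₂.1).append hX (α n) (fun r hr => hmin₂ r ⟨hr.1, hr.2.trans hm₂.2⟩)
  obtain ⟨_, ⟨t', rfl⟩, hd⟩ := hN _ _ q₂ _ _ hqg₂
    (by rw [hq₂ _ hm₂.1, hz₁]; exact Set.mem_range_self _) (by rw [hz₂]; exact Set.mem_range_self _)
    t ⟨by linarith, by linarith⟩
  rw [hq₂ t hm₂', hq₁ t (by linarith)] at hd
  refine ⟨t', ?_, hd⟩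
  have e1 := dist_triangle (α t) (β t) (α t')
  rw [hα.dist_eq, Real.dist_eq] at e1
  have e2 := hC t (by linarith)
  have e3 := le_abs_self (t - t')
  have hd' : dist (β t) (α t') ≤ R := hd
  linarith

end Coarse

/-! ### Asymptotic rays and existence of bi-infinite geodesics -/

section Boundary

variable {X : Type*} [MetricSpace X]

/-- Two parametrized rays stay at bounded distance from each other. -/
def RayClose (f g : ℝ → X) : Prop := ∃ C : ℝ, ∀ t, 0 ≤ t → dist (f t) (g t) ≤ C

theorem RayClose.symm {f g : ℝ → X} (h : RayClose f g) : RayClose g f :=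
  let ⟨C, hC⟩ := h; ⟨C, fun t ht => by rw [dist_comm]; exact hC t ht⟩

theorem RayClose.trans {f g k : ℝ → X} (h : RayClose f g) (h' : RayClose g k) : RayClose f k :=
  let ⟨C, hC⟩ := h
  let ⟨C', hC'⟩ := h'
  ⟨C + C', fun t ht => (dist_triangle _ (g t) _).trans (add_le_add (hC t ht) (hC' t ht))⟩

theorem RayClose.asymptotic {f g : ℝ → X} (h : RayClose f g) :
    Asymptotic (f '' Set.Ici 0) (g '' Set.Ici 0) := by
  obtain ⟨C, hC⟩ := h
  have : Metric.hausdorffEDist (f '' Set.Ici 0) (g '' Set.Ici 0) ≤ ENNReal.ofReal C := by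
    apply Metric.hausdorffEDist_le_of_mem_edist
    · rintro _ ⟨t, ht, rfl⟩
      exact ⟨g t, ⟨t, ht, rfl⟩, by rw [edist_dist]; exact ENNReal.ofReal_le_ofReal (hC t ht)⟩
    · rintro _ ⟨t, ht, rfl⟩
      refine ⟨f t, ⟨t, ht, rfl⟩, ?_⟩
      rw [edist_comm, edist_dist]; exact ENNReal.ofReal_le_ofReal (hC t ht)
  exact ne_top_of_le_ne_top ENNReal.ofReal_ne_top this

/-- A point of `g` close to `f t` has parameter close to `t`, since both parameters measure the
distance to the starting points. Thus Hausdorff distance can be traded for synchronous distance. -/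
theorem Asymptotic.rayClose {f g : ℝ → X} (h : Asymptotic (f '' Set.Ici 0) (g '' Set.Ici 0))
    (hf : ∀ t, 0 ≤ t → dist (f 0) (f t) = t) (hg : ∀ s t, 0 ≤ s → 0 ≤ t →
      dist (g s) (g t) = |s - t|) : RayClose f g := by
  obtain ⟨C, hC⟩ : ∃ C : ℝ≥0, Metric.hausdorffEDist (f '' Set.Ici 0) (g '' Set.Ici 0) < C :=
    ⟨_, by
      have h' := ENNReal.coe_toNNReal h
      have : (Metric.hausdorffEDist (f '' Set.Ici 0) (g '' Set.Ici 0)).toNNReal <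
        (Metric.hausdorffEDist (f '' Set.Ici 0) (g '' Set.Ici 0)).toNNReal + 1 := lt_add_one _
      rw [← ENNReal.coe_lt_coe, h'] at this
      exact this⟩
  refine ⟨2 * C + dist (f 0) (g 0), fun t ht => ?_⟩
  obtain ⟨_, ⟨s, hs, rfl⟩, hd⟩ := Metric.exists_edist_lt_of_hausdorffEDist_lt
    (Set.mem_image_of_mem f (Set.mem_Ici.2 ht)) hC
  rw [edist_nndist, ENNReal.coe_lt_coe] at hd
  have hd' : dist (f t) (g s) < C := hd
  have e1 := hg s t hs ht
  have e2 := hg 0 s le_rfl hs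
  rw [zero_sub, abs_neg, abs_of_nonneg hs] at e2
  have e3 := hf t ht
  have t1 := dist_triangle (f t) (g s) (g t)
  have t2 := dist_triangle4 (f 0) (g 0) (g s) (f t)
  have t3 := dist_triangle4 (g 0) (f 0) (f t) (g s)
  rw [dist_comm (g s) (f t)] at t2
  rw [dist_comm (g 0) (f 0)] at t3
  have : |s - t| ≤ C + dist (f 0) (g 0) := by
    rw [abs_le]; constructor <;> linarith
  linarith

/-- A ray, as a function on the real line. -/
noncomputable def Ray.real {p : X} (α : Ray p) (t : ℝ) : X := α.toFun t.toNNReal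

theorem Ray.real_zero {p : X} (α : Ray p) : α.real 0 = p := by
  simp [Ray.real, α.base]

theorem Ray.dist_real {p : X} (α : Ray p) {s t : ℝ} (hs : 0 ≤ s) (ht : 0 ≤ t) :
    dist (α.real s) (α.real t) = |s - t| := by
  rw [Ray.real, Ray.real, α.isometry.dist_eq, NNReal.dist_eq, Real.coe_toNNReal _ hs,
    Real.coe_toNNReal _ ht]

theorem Ray.dist_base {p : X} (α : Ray p) {t : ℝ} (ht : 0 ≤ t) : dist p (α.real t) = t := by
  have := α.dist_real le_rfl ht
  rwa [α.real_zero, zero_sub, abs_neg, abs_of_nonneg ht] at this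

theorem Ray.image_real {p : X} (α : Ray p) : α.real '' Set.Ici 0 = Set.range α.toFun := by
  ext x
  constructor
  · rintro ⟨t, -, rfl⟩; exact ⟨_, rfl⟩
  · rintro ⟨t, rfl⟩; exact ⟨t, t.2, by simp [Ray.real]⟩

theorem Ray.cls_eq_iff {p : X} {α β : Ray p} : α.cls = β.cls ↔ RayClose α.real β.real := by
  have : α.cls = β.cls ↔ Asymptotic (Set.range α.toFun) (Set.range β.toFun) :=
    Quotient.eq (r := raySetoid p)
  rw [this, ← Ray.image_real, ← Ray.image_real]
  refine ⟨fun h => h.rayClose (fun t ht => ?_) fun s t hs ht => β.dist_real hs ht,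
    fun h => h.asymptotic⟩
  rw [α.real_zero, α.dist_base ht]

theorem image_Iic_zero {X : Type*} (γ : ℝ → X) : γ '' Set.Iic 0 = (fun t => γ (-t)) '' Set.Ici 0 := by
  ext x
  constructor
  · rintro ⟨t, ht, rfl⟩; exact ⟨-t, by simpa using ht, by simp⟩
  · rintro ⟨t, ht, rfl⟩; exact ⟨-t, by simpa using ht, rfl⟩

theorem range_reverse {X : Type*} (γ : ℝ → X) : Set.range (fun t => γ (-t)) = Set.range γ :=
  (Equiv.neg ℝ).surjective.range_comp γ

theorem isometry_reverse {γ : ℝ → X} (h : Isometry γ) : Isometry (fun t => γ (-t)) :=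
  h.comp (IsometryEquiv.neg ℝ).isometry

theorem asymptotic_iff_rayClose {γ : ℝ → X} (h : Isometry γ) {p : X} (α : Ray p) :
    Asymptotic (γ '' Set.Ici 0) (Set.range α.toFun) ↔ RayClose γ α.real := by
  rw [← Ray.image_real]
  refine ⟨fun h' => h'.rayClose (fun t ht => ?_) fun s t hs ht => α.dist_real hs ht,
    fun h => h.asymptotic⟩
  rw [h.dist_eq, Real.dist_eq, zero_sub, abs_neg, abs_of_nonneg ht]

theorem isGeodesicFromTo_iff {p : X} {γ : ℝ → X} {a b : MorseBoundary p} :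
    IsGeodesicFromTo γ a b ↔ Isometry γ ∧
      (∃ α : Ray p, α.cls = a.1 ∧ RayClose (fun t => γ (-t)) α.real) ∧
      ∃ β : Ray p, β.cls = b.1 ∧ RayClose γ β.real := by
  unfold IsGeodesicFromTo
  refine and_congr_right fun h => and_congr ?_ ?_
  · refine exists_congr fun α => and_congr_right fun _ => ?_
    rw [image_Iic_zero]
    exact asymptotic_iff_rayClose (isometry_reverse h) α
  · exact exists_congr fun α => and_congr_right fun _ => asymptotic_iff_rayClose h α

theorem IsGeodesicFromTo.reverse {p : X} {γ : ℝ → X} {a b : MorseBoundary p}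
    (h : IsGeodesicFromTo γ a b) : IsGeodesicFromTo (fun t => γ (-t)) b a := by
  rw [isGeodesicFromTo_iff] at h ⊢
  exact ⟨isometry_reverse h.1, by simpa using h.2.2, h.2.1⟩

theorem IsGeodesicFromTo.rayClose {p : X} {γ γ' : ℝ → X} {a b c : MorseBoundary p}
    (h : IsGeodesicFromTo γ a c) (h' : IsGeodesicFromTo γ' b c) : RayClose γ γ' := by
  rw [isGeodesicFromTo_iff] at h h'
  obtain ⟨α, hα, h1⟩ := h.2.2
  obtain ⟨β, hβ, h2⟩ := h'.2.2
  exact (h1.trans (Ray.cls_eq_iff.1 (hα.trans hβ.symm))).trans h2.symm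

theorem IsMorseSet.mono {N N' : Gauge} (hN : N ≤ N') {S : Set X} (h : IsMorseSet N S) :
    IsMorseSet N' S := fun l e q s t hq hs ht w hw =>
  let ⟨y, hy, hd⟩ := h l e q s t hq hs ht w hw
  ⟨y, hy, hd.trans (NNReal.coe_le_coe.2 (hN l e))⟩

theorem IsMorseLine.mono {N N' : Gauge} (hN : N ≤ N') {γ : ℝ → X} (h : IsMorseLine N γ) :
    IsMorseLine N' γ := fun J hJ hJ' => (h J hJ hJ').mono hN

theorem IsMorseLine.range {N : Gauge} {γ : ℝ → X} (h : IsMorseLine N γ) :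
    IsMorseSet N (Set.range γ) := by
  rw [← Set.image_univ]
  exact h _ Set.ordConnected_univ isClosed_univ

theorem IsMorseLine.reverse {N : Gauge} {γ : ℝ → X} (h : IsMorseLine N γ) :
    IsMorseLine N (fun t => γ (-t)) := by
  intro J hJ hJ'
  have : (fun t => γ (-t)) '' J = γ '' (Neg.neg ⁻¹' J) := by
    rw [← Set.image_neg_eq_neg.trans (by rfl : -J = Neg.neg ⁻¹' J), Set.image_image]
  rw [this]
  exact h _ (hJ.preimage_anti fun _ _ => neg_le_neg) (hJ'.preimage continuous_neg)

/-- A limit of longer and longer geodesics through a bounded set is a bi-infinite geodesic. -/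
theorem exists_limit_line [ProperSpace X] (p : X) (g : ℕ → ℝ → X)
    (hb : ∀ t, ∃ r, ∀ᶠ n in Filter.atTop, dist (g n t) p ≤ r)
    (hg : ∀ s t, ∀ᶠ n in Filter.atTop, dist (g n s) (g n t) = dist s t) :
    ∃ γ : ℝ → X, Isometry γ ∧
      ∀ t, ∀ ε > 0, ∃ᶠ n in Filter.atTop, dist (g n t) (γ t) < ε := by
  -- Limits along a nonprincipal ultrafilter exist for all `t` at once, in place of a diagonal
  -- argument.
  have hU : (Filter.hyperfilter ℕ : Filter ℕ) ≤ Filter.atTop := Nat.hyperfilter_le_atTop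
  have hlim : ∀ t, ∃ x, Filter.Tendsto (fun n => g n t) (Filter.hyperfilter ℕ) (nhds x) := by
    intro t
    obtain ⟨r, hr⟩ := hb t
    obtain ⟨x, -, hx⟩ := (isCompact_closedBall p r).ultrafilter_le_nhds
      ((Filter.hyperfilter ℕ).map fun n => g n t)
      (Filter.le_principal_iff.2 (hU hr))
    exact ⟨x, hx⟩
  choose γ hγ using hlim
  refine ⟨γ, Isometry.of_dist_eq fun s t => ?_, fun t ε hε => ?_⟩
  · have h1 := (hγ s).dist (hγ t)
    have h2 : Filter.Tendsto (fun n => dist (g n s) (g n t)) (Filter.hyperfilter ℕ)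
        (nhds (dist s t)) :=
      tendsto_const_nhds.congr' (Filter.Eventually.mono (hU (hg s t)) fun n hn => hn.symm)
    exact tendsto_nhds_unique h1 h2
  · exact ((Metric.tendsto_nhds.1 (hγ t) ε hε).frequently).filter_mono hU

/-- Two Morse rays from `p` that are near each other at arbitrarily distant points are
asymptotic. -/
theorem Ray.rayClose_of_frequently {p : X} {α β : Ray p} {N : Gauge}
    (hβ : IsMorseSet N (Set.range β.toFun)) {R : ℝ≥0}
    (h : ∀ M : ℝ, ∃ x : X, M ≤ dist p x ∧ IsNear R x (Set.range α.toFun) ∧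
      IsNear R x (Set.range β.toFun)) : RayClose α.real β.real := by
  refine ⟨2 * (max (2 * R) (N scaleOne (0 + 2 * (2 * R))) : ℝ≥0), fun t ht => ?_⟩
  -- The level `t + R` guarantees `t ≤ s`, so `α t` lies on the geodesic from `p` to `α s`, whose
  -- endpoints are near `β`.
  obtain ⟨x, hx, ⟨_, hs', hs⟩, hu⟩ := h (t + R)
  obtain ⟨s, hs0, rfl⟩ := α.image_real.symm ▸ hs'
  have hs0 : 0 ≤ s := hs0
  have hts : t ≤ s := by
    have := dist_triangle p (α.real s) x
    rw [α.dist_base hs0, dist_comm (α.real s)] at this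
    linarith
  have hq : IsQuasiGeodesicOn scaleOne 0 α.real 0 s :=
    GeodesicOn.isQuasiGeodesicOn (fun u hu v hv => α.dist_real hu.1 hv.1) hs0
  obtain ⟨_, hv', hv⟩ := hβ.isNear_of_endpoints hq (C := 2 * R)
    ⟨p, ⟨0, β.base⟩, by rw [α.real_zero, dist_self]; exact NNReal.coe_nonneg _⟩
    (by
      have := hu.of_dist ((dist_comm _ _).trans_le hs)
      push_cast
      rwa [← two_mul] at this) t ⟨ht, hts⟩
  obtain ⟨v, hv0, rfl⟩ := β.image_real.symm ▸ hv'
  have hv0 : 0 ≤ v := hv0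
  have e1 := β.dist_real hv0 ht
  have e2 := dist_triangle p (α.real t) (β.real v)
  have e3 := dist_triangle p (β.real v) (α.real t)
  rw [dist_comm (β.real v)] at e3
  rw [α.dist_base ht, β.dist_base hv0] at e2 e3
  have e4 : |v - t| ≤ dist (α.real t) (β.real v) := by
    rw [abs_le]; constructor <;> linarith
  have e5 := dist_triangle (α.real t) (β.real v) (β.real t)
  linarith

/-- A line near a ray from `p` is asymptotic to it. -/
theorem rayClose_of_isNear {γ : ℝ → X} (hγ : Isometry γ) {p : X} (β : Ray p) {R : ℝ}
    (h : ∀ t, 0 ≤ t → IsNear R (γ t) (Set.range β.toFun)) : RayClose γ β.real := by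
  refine ⟨2 * R + dist p (γ 0), fun t ht => ?_⟩
  obtain ⟨_, hv', hv⟩ := h t ht
  obtain ⟨v, hv0, rfl⟩ := β.image_real.symm ▸ hv'
  have hv0 : 0 ≤ v := hv0
  have e0 : dist (γ 0) (γ t) = t := by
    rw [hγ.dist_eq, Real.dist_eq, zero_sub, abs_neg, abs_of_nonneg ht]
  have e1 := β.dist_real hv0 ht
  have e2 := dist_triangle4 p (γ 0) (γ t) (β.real v)
  have e3 := dist_triangle4 (γ 0) p (β.real v) (γ t)
  rw [dist_comm (β.real v), dist_comm (γ 0) p] at e3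
  rw [β.dist_base hv0] at e2 e3
  have e4 : |v - t| ≤ R + dist p (γ 0) := by
    rw [abs_le]; constructor <;> linarith
  have e5 := dist_triangle (γ t) (β.real v) (β.real t)
  linarith

/-- Distinct points of the Morse boundary are joined by a bi-infinite geodesic. -/
theorem exists_isGeodesicFromTo [ProperSpace X] (hX : IsGeodesicSpace X) {p : X}
    {a b : MorseBoundary p} (hab : a ≠ b) : ∃ γ, IsGeodesicFromTo γ a b := by
  obtain ⟨N₁, α, hα, mα⟩ := a.2
  obtain ⟨N₂, β, hβ, mβ⟩ := b.2
  replace mα := mα.mono (le_sup_left : N₁ ≤ N₁ ⊔ N₂)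
  replace mβ := mβ.mono (le_sup_right : N₂ ≤ N₁ ⊔ N₂)
  set N := N₁ ⊔ N₂
  set R := thinConst N 0
  have hmem : ∀ S : Set X, ∀ x ∈ S, IsNear (0 : ℝ≥0) x S := fun S x hx => ⟨x, hx, by simp⟩
  -- Segments from `α n` to `β n` form thin triangles with corner `p`; `w` is where they change from
  -- `α` to `β`.
  have hex : ∀ n : ℕ, ∃ (σ : ℝ → X) (ℓ w : ℝ), σ 0 = α.real n ∧ σ ℓ = β.real n ∧
      GeodesicOn σ 0 ℓ ∧ w ∈ Set.Icc 0 ℓ ∧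
      (∀ t ∈ Set.Icc 0 w, IsNear R (σ t) (Set.range α.toFun)) ∧
      ∀ t ∈ Set.Icc w ℓ, IsNear R (σ t) (Set.range β.toFun) := by
    intro n
    obtain ⟨σ, h0, h1, hσ⟩ := hX (α.real n) (β.real n)
    obtain ⟨w, hw, hw1, hw2⟩ := exists_thin_corner hX mα mβ (R := 0)
      (hmem _ p ⟨0, α.base⟩) (hmem _ p ⟨0, β.base⟩) dist_nonneg hσ
      (hmem _ _ (by rw [h0]; exact ⟨_, rfl⟩))
      (hmem _ _ (by rw [h1]; exact ⟨_, rfl⟩))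
    exact ⟨σ, _, w, h0, h1, hσ, hw, hw1, hw2⟩
  choose σ ℓ w hσ0 hσ1 hσ hw hwα hwβ using hex
  -- If the break points escaped, `α` and `β` would meet coarsely at arbitrarily large distance,
  -- hence be asymptotic.
  have hD : ∃ D, ∀ n, dist p (σ n (w n)) ≤ D := by
    by_contra! hcon
    refine hab (Subtype.ext ?_)
    rw [← hα, ← hβ, Ray.cls_eq_iff]
    refine Ray.rayClose_of_frequently mβ (R := R) fun M => ?_
    obtain ⟨n, hn⟩ := hcon M
    exact ⟨_, hn.le, hwα n _ ⟨(hw n).1, le_rfl⟩, hwβ n _ ⟨le_rfl, (hw n).2⟩⟩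
  obtain ⟨D, hD⟩ := hD
  -- Recentered at the break point, the `n`-th segment extends at least `n - D` to both sides, so
  -- the limit is defined on all of `ℝ`.
  have hlong : ∀ (t : ℝ) (n : ℕ), |t| + D ≤ n → w n + t ∈ Set.Icc 0 (ℓ n) := by
    intro t n hn
    have hℓ : 0 ≤ ℓ n := (hw n).1.trans (hw n).2
    have e1 := hσ n 0 ⟨le_rfl, hℓ⟩ (w n) (hw n)
    rw [zero_sub, abs_neg, abs_of_nonneg (hw n).1, hσ0] at e1
    have e2 := hσ n (w n) (hw n) (ℓ n) ⟨hℓ, le_rfl⟩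
    rw [abs_sub_comm, abs_of_nonneg (sub_nonneg.2 (hw n).2), hσ1] at e2
    have e3 := α.dist_base (Nat.cast_nonneg n)
    have e4 := β.dist_base (Nat.cast_nonneg n)
    have e5 := dist_triangle p (σ n (w n)) (α.real n)
    have e6 := dist_triangle p (σ n (w n)) (β.real n)
    rw [dist_comm (σ n (w n)) (α.real n)] at e5
    have e7 := hD n
    have e8 := abs_le.1 (le_refl |t|)
    constructor <;> linarith [e8.1, e8.2]
  have hev : ∀ t : ℝ, ∀ᶠ n : ℕ in Filter.atTop, w n + t ∈ Set.Icc 0 (ℓ n) := fun t =>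
    (tendsto_natCast_atTop_atTop.eventually_ge_atTop (|t| + D)).mono fun n hn => hlong t n hn
  obtain ⟨γ, hγ, hlim⟩ := exists_limit_line p (fun n t => σ n (w n + t))
    (fun t => ⟨|t| + D, (hev t).mono fun n hn => by
      have e1 := hσ n _ hn _ (hw n)
      rw [add_sub_cancel_left] at e1
      have e2 := dist_triangle (σ n (w n + t)) (σ n (w n)) p
      have e3 := hD n
      rw [dist_comm] at e3
      linarith⟩)
    (fun s t => (hev s).mp ((hev t).mono fun n hn hn' => by
      rw [hσ n _ hn' _ hn, Real.dist_eq]; congr 1; ring))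
  refine ⟨γ, isGeodesicFromTo_iff.2 ⟨hγ, ⟨α, hα, ?_⟩, β, hβ, ?_⟩⟩
  · refine rayClose_of_isNear (isometry_reverse hγ) α (R := 1 + R) fun t ht => ?_
    obtain ⟨n, hn, hn'⟩ := ((hlim (-t) 1 one_pos).and_eventually (hev (-t))).exists
    exact (hwα n _ ⟨hn'.1, by linarith⟩).of_dist (by rw [dist_comm]; exact hn.le)
  · refine rayClose_of_isNear hγ β (R := 1 + R) fun t ht => ?_
    obtain ⟨n, hn, hn'⟩ := ((hlim t 1 one_pos).and_eventually (hev t)).exists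
    exact (hwβ n _ ⟨by linarith, hn'.2⟩).of_dist (by rw [dist_comm]; exact hn.le)

end Boundary

/-! ### Thin ideal triangles, transfer of the Morse property and coarse centers -/

section Lines

variable {X : Type*} [MetricSpace X]

/-- The constant in `IsMorseLine.isNear_line`. -/
noncomputable def bigonConst (N : Gauge) : ℝ≥0 :=
  max (endConst N) (N scaleOne (0 + 2 * endConst N))

/-- A line with the same endpoints as a Morse line is uniformly near it. -/
theorem IsMorseLine.isNear_line (hX : IsGeodesicSpace X) {p : X} {a b : MorseBoundary p}
    {N : Gauge} {α β : ℝ → X} (hα : IsGeodesicFromTo α a b) (hβ : IsGeodesicFromTo β a b)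
    (hN : IsMorseLine N α) (t : ℝ) : IsNear (bigonConst N) (β t) (Set.range α) := by
  obtain ⟨C, hC⟩ := hα.rayClose hβ
  obtain ⟨C', hC'⟩ := hα.reverse.rayClose hβ.reverse
  obtain ⟨T, hT⟩ := exists_near_of_asymptotic hX hα.1 hβ.1 hN.range hC 0
  obtain ⟨T', hT'⟩ := exists_near_of_asymptotic hX (isometry_reverse hα.1)
    (isometry_reverse hβ.1) hN.reverse.range hC' 0
  set n := max (max T T') |t|
  have h1 : T ≤ n := (le_max_left _ _).trans (le_max_left _ _)
  have h2 : T' ≤ n := (le_max_right _ _).trans (le_max_left _ _)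
  have h3 : |t| ≤ n := le_max_right _ _
  obtain ⟨u, -, hu⟩ := hT n h1
  obtain ⟨v, -, hv⟩ := hT' n h2
  have h4 := abs_le.1 h3
  exact hN.range.isNear_of_endpoints
    ((isometry_geodesicOn hβ.1 (-n) n).isQuasiGeodesicOn (by linarith [abs_nonneg t]))
    ⟨_, ⟨_, rfl⟩, hv⟩ ⟨_, ⟨_, rfl⟩, hu⟩ t h4

/-- A line whose two ends are asymptotic to Morse lines `α` and `β` that have a common nearby point
breaks into a part near `α` and a part near `β`. -/
theorem exists_thin_line (hX : IsGeodesicSpace X) {N : Gauge} {α β γ : ℝ → X} (hα : Isometry α)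
    (hβ : Isometry β) (hγ : Isometry γ) (mα : IsMorseSet N (Set.range α))
    (mβ : IsMorseSet N (Set.range β)) (hγα : RayClose α (fun t => γ (-t))) (hγβ : RayClose β γ)
    {R : ℝ≥0} (hR : endConst N ≤ R) {o : X} (hoα : IsNear R o (Set.range α))
    (hoβ : IsNear R o (Set.range β)) (M : ℝ) :
    ∃ i j w, i ≤ -M ∧ M ≤ j ∧ w ∈ Set.Icc i j ∧
      (∀ t ∈ Set.Icc i w, IsNear (thinConst N R) (γ t) (Set.range α)) ∧
      ∀ t ∈ Set.Icc w j, IsNear (thinConst N R) (γ t) (Set.range β) := by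
  obtain ⟨C, hC⟩ := hγα
  obtain ⟨C', hC'⟩ := hγβ
  obtain ⟨T, hT⟩ := exists_near_of_asymptotic hX hα (isometry_reverse hγ) mα hC 0
  obtain ⟨T', hT'⟩ := exists_near_of_asymptotic hX hβ hγ mβ hC' 0
  set n := max (max T T') |M|
  have h1 : T ≤ n := (le_max_left _ _).trans (le_max_left _ _)
  have h2 : T' ≤ n := (le_max_right _ _).trans (le_max_left _ _)
  have h3 : |M| ≤ n := le_max_right _ _
  obtain ⟨u, -, hu⟩ := hT n h1
  obtain ⟨v, -, hv⟩ := hT' n h2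
  have hR' : (endConst N : ℝ) ≤ R := NNReal.coe_le_coe.2 hR
  obtain ⟨w, hw, hw1, hw2⟩ := exists_thin_corner hX mα mβ hoα hoβ (i := -n) (j := n)
    (by linarith [abs_nonneg M]) (isometry_geodesicOn hγ _ _) ⟨_, ⟨_, rfl⟩, hu.trans hR'⟩
    ⟨_, ⟨_, rfl⟩, hv.trans hR'⟩
  exact ⟨-n, n, w, by linarith [le_abs_self M], by linarith [le_abs_self M], hw, hw1, hw2⟩

/-- The thinness constant of ideal triangles. -/
noncomputable def triangleConst (N : Gauge) : ℝ≥0 := thinConst N (endConst N)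

/-- Far out towards `c` the sides `α` and `β` are uniformly close; a point of `β` there serves as
the corner `o` of `exists_thin_line`. -/
theorem exists_thin_triangle (hX : IsGeodesicSpace X) {p : X} {a b c : MorseBoundary p}
    {N : Gauge} {α β γ : ℝ → X} (hγ : IsGeodesicFromTo γ a b) (hβ : IsGeodesicFromTo β b c)
    (hα : IsGeodesicFromTo α c a) (mα : IsMorseLine N α) (mβ : IsMorseLine N β) (M : ℝ) :
    ∃ i j w, i ≤ -M ∧ M ≤ j ∧ w ∈ Set.Icc i j ∧
      (∀ t ∈ Set.Icc i w, IsNear (triangleConst N) (γ t) (Set.range α)) ∧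
      ∀ t ∈ Set.Icc w j, IsNear (triangleConst N) (γ t) (Set.range β) := by
  obtain ⟨C, hC⟩ := hα.reverse.rayClose hβ
  obtain ⟨T, hT⟩ := exists_near_of_asymptotic hX (isometry_reverse hα.1) hβ.1 mα.reverse.range hC 0
  obtain ⟨u, -, hu⟩ := hT T le_rfl
  have := exists_thin_line hX hα.1 (isometry_reverse hβ.1) hγ.1 mα.range mβ.reverse.range
    (hα.rayClose hγ.reverse) (hβ.reverse.rayClose hγ) le_rfl (o := β T) ⟨_, ⟨_, rfl⟩, hu⟩
    ⟨_, ⟨-T, rfl⟩, by simp⟩ M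
  rwa [range_reverse β] at this

/-- Sides of ideal triangles are near the union of the two other sides. -/
theorem isNear_or_isNear (hX : IsGeodesicSpace X) {p : X} {a b c : MorseBoundary p}
    {N : Gauge} {α β γ : ℝ → X} (hγ : IsGeodesicFromTo γ a b) (hβ : IsGeodesicFromTo β b c)
    (hα : IsGeodesicFromTo α c a) (mα : IsMorseLine N α) (mβ : IsMorseLine N β) (t : ℝ) :
    IsNear (triangleConst N) (γ t) (Set.range α) ∨
      IsNear (triangleConst N) (γ t) (Set.range β) := by
  obtain ⟨i, j, w, hi, hj, -, h1, h2⟩ := exists_thin_triangle hX hγ hβ hα mα mβ |t|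
  have := abs_le.1 (le_refl |t|)
  rcases le_total t w with h | h
  · exact Or.inl (h1 t ⟨by linarith, h⟩)
  · exact Or.inr (h2 t ⟨h, by linarith⟩)

/-- Internal triples exist, with a constant that depends only on the gauge. -/
theorem exists_isInternalConstant (hX : IsGeodesicSpace X) (p : X) (N : Gauge) :
    ∃ K, IsInternalConstant p N K := by
  refine ⟨2 * triangleConst N + 1, by positivity, fun v T hT hN => ?_⟩
  -- The break point of one side is near both other sides; its two feet complete the triple.
  obtain ⟨i, j, w, -, -, hw, h1, h2⟩ := exists_thin_triangle hX hT.1 hT.2.1 hT.2.2 (hN 2) (hN 1) 0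
  obtain ⟨_, ⟨s, rfl⟩, hs⟩ := h1 w ⟨hw.1, le_rfl⟩
  obtain ⟨_, ⟨u, rfl⟩, hu⟩ := h2 w ⟨le_rfl, hw.2⟩
  have h0 : (0 : ℝ) ≤ triangleConst N := NNReal.coe_nonneg _
  have h3 := dist_triangle (T 2 s) (T 0 w) (T 1 u)
  rw [dist_comm (T 2 s) (T 0 w)] at h3
  refine ⟨![w, u, s], fun i j => ?_⟩
  fin_cases i <;> fin_cases j <;>
    simp only [Fin.zero_eta, Fin.mk_one, Fin.reduceFinMk, Matrix.cons_val, dist_self] <;>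
    first
    | positivity
    | linarith
    | (rw [dist_comm]; linarith)

/-- A line is Morse if its quasi-geodesics with ordered endpoints are near the geodesic segments
between these endpoints. -/
theorem IsMorseLine.of_segments {N : Gauge} {γ : ℝ → X}
    (h : ∀ (l : Set.Ici (1 : ℝ)) (e : ℝ≥0) (i j : ℝ), i ≤ j → ∀ (q : ℝ → X) (s t : ℝ),
      IsQuasiGeodesicOn l e q s t → q s = γ i → q t = γ j →
      ∀ w ∈ Set.Icc s t, IsNear (N l e) (q w) (γ '' Set.Icc i j)) : IsMorseLine N γ := by
  rintro J hJ - l e q s t hq ⟨i, hi, his⟩ ⟨j, hj, hjt⟩ w hw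
  rcases le_total i j with hij | hij
  · obtain ⟨_, ⟨k, hk, rfl⟩, hd⟩ := h l e i j hij q s t hq his.symm hjt.symm w hw
    exact ⟨_, ⟨k, hJ.out hi hj hk, rfl⟩, hd⟩
  · obtain ⟨_, ⟨k, hk, rfl⟩, hd⟩ := h l e j i hij _ _ _ hq.reverse (by simpa using hjt.symm)
      (by simpa using his.symm) (-w) ⟨by linarith [hw.2], by linarith [hw.1]⟩
    exact ⟨_, ⟨k, hJ.out hj hi hk, rfl⟩, by simpa using hd⟩

/-- The constant in `IsMorseLine.isNear_segment`. -/
noncomputable def segmentConst (N : Gauge) (R : ℝ≥0) (l : Set.Ici (1 : ℝ)) (e : ℝ≥0) : ℝ≥0 :=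
  max R (N l (e + 2 * R)) + (2 * max R (N scaleOne (0 + 2 * R)) + 3 * R)

/-- Geodesic segments with endpoints near a Morse line are Morse. -/
theorem IsMorseLine.isNear_segment {N : Gauge} {α γ : ℝ → X} (hα : Isometry α)
    (hN : IsMorseLine N α) (hγ : Isometry γ) {R : ℝ≥0} {i j : ℝ} (hij : i ≤ j)
    (hi : IsNear R (γ i) (Set.range α)) (hj : IsNear R (γ j) (Set.range α))
    {l : Set.Ici (1 : ℝ)} {e : ℝ≥0} {q : ℝ → X} {s t : ℝ} (hq : IsQuasiGeodesicOn l e q s t)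
    (hs : q s = γ i) (ht : q t = γ j) :
    ∀ w ∈ Set.Icc s t, IsNear (segmentConst N R l e) (q w) (γ '' Set.Icc i j) := by
  intro w hw
  obtain ⟨_, ⟨i', rfl⟩, hi'⟩ := hi
  obtain ⟨_, ⟨j', rfl⟩, hj'⟩ := hj
  -- The Morse condition is used for the subsegment, not the whole line, to keep the foot `α k`
  -- between `α i'` and `α j'`.
  have hm := hN (Set.uIcc i' j') Set.ordConnected_uIcc isClosed_Icc
  have ni : IsNear R (γ i) (α '' Set.uIcc i' j') := ⟨_, ⟨i', Set.left_mem_uIcc, rfl⟩, hi'⟩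
  have nj : IsNear R (γ j) (α '' Set.uIcc i' j') := ⟨_, ⟨j', Set.right_mem_uIcc, rfl⟩, hj'⟩
  obtain ⟨_, ⟨k, hk, rfl⟩, hk'⟩ := hm.isNear_of_endpoints hq (C := R) (by rwa [hs]) (by rwa [ht])
    w hw
  set B : ℝ≥0 := max R (N scaleOne (0 + 2 * R)) with hB
  have hRB : (R : ℝ) ≤ B := NNReal.coe_le_coe.2 (le_max_left _ _)
  have hR0 : (0 : ℝ) ≤ R := R.2
  have len : |j' - i'| ≤ (j - i) + 2 * R := by
    have e1 := dist_triangle4 (α i') (γ i) (γ j) (α j')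
    rw [hα.dist_eq, hγ.dist_eq, Real.dist_eq, Real.dist_eq, abs_sub_comm, abs_sub_comm i,
      abs_of_nonneg (sub_nonneg.2 hij), dist_comm (α i')] at e1
    linarith
  have hkl : |k - i'| ≤ |j' - i'| := Set.abs_sub_left_of_mem_uIcc hk
  -- `γ r` is the counterpart of `α k` at the same distance from the start. The minimum is needed
  -- since the segment of `α` may be longer than that of `γ`, by up to `2 * R`.
  set r := min (i + |k - i'|) j with hr
  have hri : i ≤ r := le_min (by linarith [abs_nonneg (k - i')]) hij
  have hrj : r ≤ j := min_le_right _ _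
  have hr1 : r - i ≤ |k - i'| := by linarith [min_le_left (i + |k - i'|) j]
  have hr2 : |k - i'| ≤ r - i + 2 * R := by
    rcases min_choice (i + |k - i'|) j with h | h <;> rw [← hr] at h <;> linarith
  obtain ⟨_, ⟨k', hk'm, rfl⟩, hd⟩ := hm.isNear_of_endpoints
    ((isometry_geodesicOn hγ i j).isQuasiGeodesicOn hij) (C := R) ni nj r ⟨hri, hrj⟩
  rw [← hB] at hd
  have f1 : dist (α i') (α k') ≤ R + (r - i) + B := by
    have e1 := dist_triangle4 (α i') (γ i) (γ r) (α k')
    rw [hγ.dist_eq, Real.dist_eq, abs_sub_comm, abs_of_nonneg (sub_nonneg.2 hri),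
      dist_comm (α i') (γ i)] at e1
    linarith
  have f2 : r - i ≤ R + dist (α i') (α k') + B := by
    have e1 := dist_triangle4 (γ i) (α i') (α k') (γ r)
    rw [hγ.dist_eq, Real.dist_eq, abs_sub_comm, abs_of_nonneg (sub_nonneg.2 hri),
      dist_comm (α k') (γ r)] at e1
    linarith
  rw [hα.dist_eq, Real.dist_eq, abs_sub_comm] at f1 f2
  have f3 : |k - k'| ≤ B + 3 * R := by
    -- Both `k` and `k'` lie on the same side of `i'`, so their distances to `i'` determine their
    -- difference.
    rcases le_total i' j' with h | h
    · rw [Set.uIcc_of_le h] at hk hk'm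
      rw [abs_of_nonneg (sub_nonneg.2 hk.1)] at hr1 hr2
      rw [abs_of_nonneg (sub_nonneg.2 hk'm.1)] at f1 f2
      rw [abs_le]; constructor <;> linarith
    · rw [Set.uIcc_of_ge h] at hk hk'm
      rw [abs_of_nonpos (sub_nonpos.2 hk.2)] at hr1 hr2
      rw [abs_of_nonpos (sub_nonpos.2 hk'm.2)] at f1 f2
      rw [abs_le]; constructor <;> linarith
  refine ⟨γ r, ⟨r, ⟨hri, hrj⟩, rfl⟩, ?_⟩
  have f4 := dist_triangle4 (q w) (α k) (α k') (γ r)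
  rw [hα.dist_eq, Real.dist_eq, dist_comm (α k')] at f4
  rw [segmentConst, ← hB]
  push_cast [-NNReal.coe_max]
  linarith

/-- A geodesic segment made up of two Morse segments is Morse. -/
theorem isNear_segment_of_split (hX : IsGeodesicSpace X) {γ : ℝ → X} {i j m : ℝ} (him : i ≤ m)
    (hmj : m ≤ j) {l : Set.Ici (1 : ℝ)} {e : ℝ≥0} {B : ℝ}
    (h₁ : ∀ (q : ℝ → X) (s t : ℝ), IsQuasiGeodesicOn (scaleTriple l) (e + 1) q s t → q s = γ i →
      q t = γ m → ∀ w ∈ Set.Icc s t, IsNear B (q w) (γ '' Set.Icc i m))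
    (h₂ : ∀ (q : ℝ → X) (s t : ℝ), IsQuasiGeodesicOn (scaleTriple l) (e + 1) q s t → q s = γ m →
      q t = γ j → ∀ w ∈ Set.Icc s t, IsNear B (q w) (γ '' Set.Icc m j))
    {q : ℝ → X} {s t : ℝ} (hq : IsQuasiGeodesicOn l e q s t) (hs : q s = γ i) (ht : q t = γ j) :
    ∀ w ∈ Set.Icc s t, IsNear B (q w) (γ '' Set.Icc i j) := by
  intro w hw
  -- Cut `q` almost nearest to `γ m` and join either half to `γ m` by a geodesic.
  obtain ⟨u, hu, hmin⟩ := exists_almost_nearest q hq.1 (γ m)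
  rcases le_total w u with hwu | hwu
  · obtain ⟨q', L, hL, hq', hz, hqg⟩ := (hq.mono le_rfl hu.2 hu.1).append hX (γ m)
      fun r hr => hmin r ⟨hr.1, hr.2.trans hu.2⟩
    obtain ⟨_, ⟨k, hk, rfl⟩, hd⟩ := h₁ q' _ _ hqg (by rw [hq' _ hu.1, hs]) hz w
      ⟨hw.1, by linarith⟩
    rw [hq' w hwu] at hd
    exact ⟨_, ⟨k, ⟨hk.1, hk.2.trans hmj⟩, rfl⟩, hd⟩
  · obtain ⟨q', L, hL, hq', hz, hqg⟩ := (hq.mono hu.1 le_rfl hu.2).prepend hX (γ m)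
      fun r hr => hmin r ⟨hu.1.trans hr.1, hr.2⟩
    obtain ⟨_, ⟨k, hk, rfl⟩, hd⟩ := h₂ q' _ _ hqg hz (by rw [hq' _ hu.2, ht]) w
      ⟨by linarith, hw.2⟩
    rw [hq' w hwu] at hd
    exact ⟨_, ⟨k, ⟨him.trans hk.1, hk.2⟩, rfl⟩, hd⟩

/-- The gauge in `IsGeodesicFromTo.isMorseLine_of_common_point`. -/
noncomputable def joinGauge (N : Gauge) (K : ℝ≥0) : Gauge := fun l e =>
  max (segmentConst N (thinConst N (max (endConst N) K)) l e)
    (segmentConst N (thinConst N (max (endConst N) K)) (scaleTriple l) (e + 1))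

/-- If `x` is near a Morse line that ends in `a` and a Morse line that ends in `b`, then lines from
`a` to `b` are Morse, for a gauge that depends only on the data. -/
theorem IsGeodesicFromTo.isMorseLine_of_common_point (hX : IsGeodesicSpace X) {p : X}
    {a b a' b' : MorseBoundary p} {N : Gauge} {α β γ : ℝ → X} (hα : IsGeodesicFromTo α a' a)
    (hβ : IsGeodesicFromTo β b' b) (mα : IsMorseLine N α) (mβ : IsMorseLine N β) {K : ℝ≥0} {x : X}
    (hxα : IsNear K x (Set.range α)) (hxβ : IsNear K x (Set.range β))
    (hγ : IsGeodesicFromTo γ a b) : IsMorseLine (joinGauge N K) γ := by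
  refine IsMorseLine.of_segments fun l e i j hij q s t hq hs ht w hw => ?_
  set R := thinConst N (max (endConst N) K) with hR
  have hK : (K : ℝ) ≤ (max (endConst N) K : ℝ≥0) := NNReal.coe_le_coe.2 (le_max_right _ _)
  obtain ⟨i', j', m, hi', hj', hm, h1, h2⟩ := exists_thin_line hX hα.1 hβ.1 hγ.1 mα.range mβ.range
    (hα.rayClose hγ.reverse) (hβ.rayClose hγ) (le_max_left _ K) (hxα.mono hK) (hxβ.mono hK)
    (max |i| |j|)
  have hi := abs_le.1 (le_max_left |i| |j|)
  have hj := abs_le.1 (le_max_right |i| |j|)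
  have c1 : (segmentConst N R l e : ℝ) ≤ joinGauge N K l e := NNReal.coe_le_coe.2 (le_max_left _ _)
  have c2 : (segmentConst N R (scaleTriple l) (e + 1) : ℝ) ≤ joinGauge N K l e :=
    NNReal.coe_le_coe.2 (le_max_right _ _)
  -- The segment lies on the `β` side of the break point, on the `α` side, or straddles it; only the
  -- last case worsens the quasi-geodesic constants.
  rcases le_total m i with hmi | hmi
  · exact (mβ.isNear_segment hβ.1 hγ.1 hij (h2 i ⟨hmi, by linarith⟩)
      (h2 j ⟨hmi.trans hij, by linarith⟩) hq hs ht w hw).mono c1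
  rcases le_total j m with hjm | hjm
  · exact (mα.isNear_segment hα.1 hγ.1 hij (h1 i ⟨by linarith, hij.trans hjm⟩)
      (h1 j ⟨by linarith, hjm⟩) hq hs ht w hw).mono c1
  refine (isNear_segment_of_split hX hmi hjm (fun q s t hq hs ht => ?_)
    (fun q s t hq hs ht => ?_) hq hs ht w hw).mono c2
  · exact mα.isNear_segment hα.1 hγ.1 hmi (h1 i ⟨by linarith, hmi⟩) (h1 m ⟨hm.1, le_rfl⟩) hq hs ht
  · exact mβ.isNear_segment hβ.1 hγ.1 hjm (h2 m ⟨le_rfl, hm.2⟩) (h2 j ⟨hjm, by linarith⟩) hq hs ht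

/-- A point near a geodesic has small Gromov product of points near the geodesic on either
side. -/
theorem dist_add_dist_le {γ : ℝ → X} (hγ : Isometry γ) {x P Q : X} {K R s u v : ℝ}
    (hx : dist x (γ s) ≤ K) (hP : dist P (γ u) ≤ R) (hQ : dist Q (γ v) ≤ R) (hus : u ≤ s)
    (hsv : s ≤ v) : dist x P + dist x Q ≤ dist P Q + (2 * K + 4 * R) := by
  have e1 := dist_triangle4 x (γ s) (γ u) P
  have e2 := dist_triangle4 x (γ s) (γ v) Q
  have e3 := dist_triangle4 (γ u) P Q (γ v)
  rw [hγ.dist_eq, Real.dist_eq] at e1 e2 e3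
  rw [abs_of_nonneg (sub_nonneg.2 hus), dist_comm (γ u) P] at e1
  rw [abs_sub_comm, abs_of_nonneg (sub_nonneg.2 hsv), dist_comm (γ v) Q] at e2
  rw [abs_sub_comm, abs_of_nonneg (sub_nonneg.2 (hus.trans hsv)), dist_comm (γ u) P] at e3
  linarith

/-- Points near all three sides of an ideal triangle are near each other. -/
theorem IsIdealTriangle.dist_le (hX : IsGeodesicSpace X) {p : X} {v : Fin 3 → MorseBoundary p}
    {T : Fin 3 → ℝ → X} (hT : IsIdealTriangle v T) {N : Gauge} (hN : ∀ i, IsMorseLine N (T i))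
    {K : ℝ} {x y : X} (hx : ∀ i, IsNear K x (Set.range (T i)))
    (hy : ∀ i, IsNear K y (Set.range (T i))) : dist x y ≤ 7 * K + 8 * endConst N := by
  have hx' : ∀ i, ∃ s, dist x (T i s) ≤ K := fun i => by
    obtain ⟨_, ⟨s, rfl⟩, h⟩ := hx i; exact ⟨s, h⟩
  have hy' : ∀ i, ∃ s, dist y (T i s) ≤ K := fun i => by
    obtain ⟨_, ⟨s, rfl⟩, h⟩ := hy i; exact ⟨s, h⟩
  choose s hs using hx'
  choose t ht using hy'
  obtain ⟨M, hMs, hMt⟩ : ∃ M, (∀ i, |s i| ≤ M) ∧ ∀ i, |t i| ≤ M := by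
    refine ⟨∑ i, |s i| + ∑ i, |t i|, fun i => ?_, fun i => ?_⟩
    · have := Finset.single_le_sum (f := fun i => |s i|) (fun i _ => abs_nonneg _)
        (Finset.mem_univ i)
      have h2 : 0 ≤ ∑ i, |t i| := Finset.sum_nonneg fun i _ => abs_nonneg _
      linarith
    · have := Finset.single_le_sum (f := fun i => |t i|) (fun i _ => abs_nonneg _)
        (Finset.mem_univ i)
      have h2 : 0 ≤ ∑ i, |s i| := Finset.sum_nonneg fun i _ => abs_nonneg _
      linarith
  -- Near each ideal vertex, beyond all the feet of `x` and `y`, the two adjacent sides have nearby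
  -- points. These replace the ideal vertices by three points of `X`.
  have key : ∀ {a b c : MorseBoundary p} {α β : ℝ → X}, IsGeodesicFromTo α a b →
      IsGeodesicFromTo β b c → IsMorseLine N α →
      ∃ n m, M ≤ n ∧ M ≤ m ∧ dist (β (-n)) (α m) ≤ endConst N := by
    intro a b c α β hα hβ hm
    obtain ⟨C, hC⟩ := hα.rayClose hβ.reverse
    obtain ⟨T, hT⟩ := exists_near_of_asymptotic hX hα.1 (isometry_reverse hβ.1) hm.range hC M
    obtain ⟨m, hm, hd⟩ := hT (max T M) (le_max_left _ _)
    exact ⟨_, m, le_max_right _ _, hm, hd⟩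
  obtain ⟨na, ma, hna, hma, ha⟩ := key hT.2.2 hT.1 (hN 2)
  obtain ⟨nb, mb, hnb, hmb, hb⟩ := key hT.1 hT.2.1 (hN 0)
  obtain ⟨nc, mc, hnc, hmc, hc⟩ := key hT.2.1 hT.2.2 (hN 1)
  set R : ℝ := (endConst N : ℝ) with hR
  have hR0 : 0 ≤ R := NNReal.coe_nonneg _
  have hs' := fun i => abs_le.1 (hMs i)
  have ht' := fun i => abs_le.1 (hMt i)
  have hself : ∀ z : X, dist z z ≤ R := fun z => by rw [dist_self]; exact hR0
  have x0 := dist_add_dist_le hT.1.1 (hs 0) (hself (T 0 (-na))) hb (by linarith [(hs' 0).1])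
    (by linarith [(hs' 0).2])
  have y0 := dist_add_dist_le hT.1.1 (ht 0) (hself (T 0 (-na))) hb (by linarith [(ht' 0).1])
    (by linarith [(ht' 0).2])
  have x1 := dist_add_dist_le hT.2.1.1 (hs 1) (hself (T 1 (-nb))) hc (by linarith [(hs' 1).1])
    (by linarith [(hs' 1).2])
  have y1 := dist_add_dist_le hT.2.1.1 (ht 1) (hself (T 1 (-nb))) hc (by linarith [(ht' 1).1])
    (by linarith [(ht' 1).2])
  have x2 := dist_add_dist_le hT.2.2.1 (hs 2) (hself (T 2 (-nc))) ha (by linarith [(hs' 2).1])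
    (by linarith [(hs' 2).2])
  have y2 := dist_add_dist_le hT.2.2.1 (ht 2) (hself (T 2 (-nc))) ha (by linarith [(ht' 2).1])
    (by linarith [(ht' 2).2])
  have lx0 := dist_triangle_left (T 0 (-na)) (T 1 (-nb)) x
  have ly0 := dist_triangle_left (T 0 (-na)) (T 1 (-nb)) y
  have lx1 := dist_triangle_left (T 1 (-nb)) (T 2 (-nc)) x
  have ly1 := dist_triangle_left (T 1 (-nb)) (T 2 (-nc)) y
  have lx2 := dist_triangle_left (T 2 (-nc)) (T 0 (-na)) x
  have ly2 := dist_triangle_left (T 2 (-nc)) (T 0 (-na)) y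
  have px : ∀ z u, dist z (T 0 u) ≤ K → |u| ≤ M →
      |dist z (T 0 (-na)) - (u + na)| ≤ K := by
    intro z u hz hu
    have e : dist (T 0 u) (T 0 (-na)) = u + na := by
      rw [hT.1.1.dist_eq, Real.dist_eq, sub_neg_eq_add,
        abs_of_nonneg (by linarith [(abs_le.1 hu).1])]
    have t1 := dist_triangle z (T 0 u) (T 0 (-na))
    have t2 := dist_triangle_left (T 0 u) (T 0 (-na)) z
    rw [abs_le]; constructor <;> linarith
  have bx := abs_le.1 (px x _ (hs 0) (hMs 0))
  have by' := abs_le.1 (px y _ (ht 0) (hMt 0))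
  -- For `x` and `y` alike, the sums of distances to two of the three points agree coarsely with the
  -- lengths of the triangle. This linear system determines the distance to `T 0 (-na)`, hence the
  -- foot on side `0`.
  have hst : |s 0 - t 0| ≤ 5 * K + 8 * R := by
    rw [abs_le]; constructor <;> linarith [bx.1, bx.2, by'.1, by'.2]
  have fin := dist_triangle4 x (T 0 (s 0)) (T 0 (t 0)) y
  rw [hT.1.1.dist_eq, Real.dist_eq, dist_comm (T 0 (t 0)) y] at fin
  linarith [hs 0, ht 0]

end Lines

/-! ### Centers in terms of pairs of boundary points -/

section Centers

variable {X : Type*} [MetricSpace X] {p : X}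

/-- `a` and `b` are distinct, and all geodesics from `a` to `b` are `N`-Morse. -/
def MorsePair (N : Gauge) (a b : MorseBoundary p) : Prop :=
  a ≠ b ∧ ∀ γ : ℝ → X, IsGeodesicFromTo γ a b → IsMorseLine N γ

/-- `x` is within `K` of a geodesic from `a` to `b`, where `(a, b)` is a pair of gauge `N`. -/
def NearPair (N : Gauge) (K : ℝ) (x : X) (a b : MorseBoundary p) : Prop :=
  MorsePair N a b ∧ ∃ γ : ℝ → X, IsGeodesicFromTo γ a b ∧ IsNear K x (Set.range γ)

theorem MorsePair.symm {N : Gauge} {a b : MorseBoundary p} (h : MorsePair N a b) :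
    MorsePair N b a :=
  ⟨h.1.symm, fun γ hγ => by simpa using (h.2 _ hγ.reverse).reverse⟩

theorem MorsePair.mono {N N' : Gauge} (hN : N ≤ N') {a b : MorseBoundary p}
    (h : MorsePair N a b) : MorsePair N' a b := ⟨h.1, fun γ hγ => (h.2 γ hγ).mono hN⟩

theorem NearPair.symm {N : Gauge} {K : ℝ} {x : X} {a b : MorseBoundary p}
    (h : NearPair N K x a b) : NearPair N K x b a := by
  obtain ⟨h, γ, hγ, hx⟩ := h
  exact ⟨h.symm, _, hγ.reverse, by rwa [range_reverse]⟩

theorem NearPair.mono {N N' : Gauge} (hN : N ≤ N') {K K' : ℝ} (hK : K ≤ K') {x : X}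
    {a b : MorseBoundary p} (h : NearPair N K x a b) : NearPair N' K' x a b :=
  let ⟨h, γ, hγ, hx⟩ := h
  ⟨h.mono hN, γ, hγ, hx.mono hK⟩

theorem mem_morseTuples_iff {n : ℕ} {N : Gauge} {v : Fin n → MorseBoundary p} :
    v ∈ morseTuples p n N ↔ ∀ i j, i ≠ j → MorsePair N (v i) (v j) :=
  ⟨fun h i j hij => ⟨h.1.ne hij, h.2 i j hij⟩, fun h =>
    ⟨fun i j hv => by_contra fun hij => (h i j hij).1 hv, fun i j hij => (h i j hij).2⟩⟩

/-- The sides of an ideal triangle can be chosen independently, so the condition splits over pairs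
of vertices. This is what lets vertices be exchanged singly. -/
theorem mem_centers_iff {N : Gauge} {K : ℝ} {v : Fin 3 → MorseBoundary p} {x : X} :
    x ∈ centers p N K v ↔ NearPair N K x (v 0) (v 1) ∧ NearPair N K x (v 1) (v 2) ∧
      NearPair N K x (v 2) (v 0) := by
  constructor
  · rintro ⟨hv, T, hT, hx⟩
    rw [mem_morseTuples_iff] at hv
    have hx' : ∀ i, IsNear K x (Set.range (T i)) := fun i =>
      let ⟨t, ht⟩ := hx i; ⟨_, ⟨t, rfl⟩, ht⟩
    exact ⟨⟨hv 0 1 (by decide), _, hT.1, hx' 0⟩, ⟨hv 1 2 (by decide), _, hT.2.1, hx' 1⟩,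
      ⟨hv 2 0 (by decide), _, hT.2.2, hx' 2⟩⟩
  · rintro ⟨⟨h0, γ0, hγ0, _, ⟨t0, rfl⟩, d0⟩, ⟨h1, γ1, hγ1, _, ⟨t1, rfl⟩, d1⟩,
      ⟨h2, γ2, hγ2, _, ⟨t2, rfl⟩, d2⟩⟩
    refine ⟨mem_morseTuples_iff.2 fun i j hij => ?_, ![γ0, γ1, γ2], ⟨hγ0, hγ1, hγ2⟩, fun i => ?_⟩
    · fin_cases i <;> fin_cases j <;>
        first
        | exact absurd rfl hij
        | exact h0
        | exact h1
        | exact h2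
        | exact h0.symm
        | exact h1.symm
        | exact h2.symm
    · fin_cases i
      exacts [⟨t0, d0⟩, ⟨t1, d1⟩, ⟨t2, d2⟩]

theorem mem_centers_vec {N : Gauge} {K : ℝ} {a b c : MorseBoundary p} {x : X} :
    x ∈ centers p N K ![a, b, c] ↔ NearPair N K x a b ∧ NearPair N K x b c ∧ NearPair N K x c a :=
  mem_centers_iff

theorem centers_mono {N N' : Gauge} (hN : N ≤ N') {K K' : ℝ} (hK : K ≤ K')
    {v : Fin 3 → MorseBoundary p} : centers p N K v ⊆ centers p N' K' v := fun x hx => by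
  rw [mem_centers_iff] at hx ⊢
  exact ⟨hx.1.mono hN hK, hx.2.1.mono hN hK, hx.2.2.mono hN hK⟩

theorem mem_centers_of_dist_le {N : Gauge} {K R : ℝ} {v : Fin 3 → MorseBoundary p} {x x' : X}
    (h : x' ∈ centers p N K v) (hd : dist x x' ≤ R) : x ∈ centers p N (R + K) v := by
  have aux : ∀ {a b : MorseBoundary p}, NearPair N K x' a b → NearPair N (R + K) x a b :=
    fun ⟨h, γ, hγ, hx⟩ => ⟨h, γ, hγ, hx.of_dist hd⟩
  rw [mem_centers_iff] at h ⊢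
  exact ⟨aux h.1, aux h.2.1, aux h.2.2⟩

theorem morseTuples_mono {n : ℕ} {N N' : Gauge} (hN : N ≤ N') :
    morseTuples p n N ⊆ morseTuples p n N' := fun _ hv =>
  mem_morseTuples_iff.2 fun i j hij => (mem_morseTuples_iff.1 hv i j hij).mono hN

theorem mem_morseTuples_vec_two {N : Gauge} {a b : MorseBoundary p} (h : MorsePair N a b) :
    ![a, b] ∈ morseTuples p 2 N :=
  mem_morseTuples_iff.2 fun i j hij => by
    fin_cases i <;> fin_cases j <;>
      first
      | exact absurd rfl hij
      | exact h
      | exact h.symm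

theorem MapsTuples.morsePair {Y : Type*} [MetricSpace Y] {r : Y}
    {h : MorseBoundary p → MorseBoundary r} {N N' : Gauge} (hh : MapsTuples h 2 N N')
    {a b : MorseBoundary p} (hab : MorsePair N a b) : MorsePair N' (h a) (h b) :=
  mem_morseTuples_iff.1 (hh _ (mem_morseTuples_vec_two hab)) 0 1 (by decide)

theorem MapsTuples.of_two {Y : Type*} [MetricSpace Y] {r : Y}
    {h : MorseBoundary p → MorseBoundary r} {N N' : Gauge} (hh : MapsTuples h 2 N N') (n : ℕ) :
    MapsTuples h n N N' := fun _ hv =>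
  mem_morseTuples_iff.2 fun i j hij => hh.morsePair (mem_morseTuples_iff.1 hv i j hij)

/-- Triples of gauge `N` have centers. -/
theorem centers_nonempty [ProperSpace X] (hX : IsGeodesicSpace X) {N : Gauge} {K : ℝ}
    (hK : IsInternalConstant p N K) {v : Fin 3 → MorseBoundary p} (hv : v ∈ morseTuples p 3 N) :
    (centers p N K v).Nonempty := by
  have hv' := mem_morseTuples_iff.1 hv
  obtain ⟨γ0, h0⟩ := exists_isGeodesicFromTo hX (hv' 0 1 (by decide)).1
  obtain ⟨γ1, h1⟩ := exists_isGeodesicFromTo hX (hv' 1 2 (by decide)).1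
  obtain ⟨γ2, h2⟩ := exists_isGeodesicFromTo hX (hv' 2 0 (by decide)).1
  have hT : IsIdealTriangle v ![γ0, γ1, γ2] := ⟨h0, h1, h2⟩
  obtain ⟨t, ht⟩ := hK.2 v _ hT (fun i => by
    fin_cases i
    exacts [(hv' 0 1 (by decide)).2 _ h0, (hv' 1 2 (by decide)).2 _ h1,
      (hv' 2 0 (by decide)).2 _ h2])
  exact ⟨_, hv, _, hT, fun i => ⟨t i, ht 0 i⟩⟩

/-- Sets of centers are bounded in terms of the gauge and the constant. -/
theorem exists_dist_centers_le (hX : IsGeodesicSpace X) (p : X) (N : Gauge) (K : ℝ) :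
    ∃ D : ℝ, ∀ (v : Fin 3 → MorseBoundary p), ∀ x ∈ centers p N K v, ∀ y ∈ centers p N K v,
      dist x y ≤ D := by
  refine ⟨7 * (K + bigonConst N) + 8 * endConst N, ?_⟩
  rintro v x ⟨hv, T, hT, hx⟩ y ⟨-, T', hT', hy⟩
  have hN : ∀ i, IsMorseLine N (T i) := fun i => by
    have hv' := mem_morseTuples_iff.1 hv
    fin_cases i
    exacts [(hv' 0 1 (by decide)).2 _ hT.1, (hv' 1 2 (by decide)).2 _ hT.2.1,
      (hv' 2 0 (by decide)).2 _ hT.2.2]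
  -- The two centers may come from different triangles; the thinness of bigons reduces this to one
  -- triangle.
  have hline : ∀ i s, IsNear (bigonConst N) (T' i s) (Set.range (T i)) := fun i s => by
    fin_cases i
    exacts [(hN 0).isNear_line hX hT.1 hT'.1 s, (hN 1).isNear_line hX hT.2.1 hT'.2.1 s,
      (hN 2).isNear_line hX hT.2.2 hT'.2.2 s]
  refine hT.dist_le hX hN (fun i => ?_) fun i => ?_
  · obtain ⟨s, hs⟩ := hx i
    exact ⟨_, ⟨s, rfl⟩, hs.trans (le_add_of_nonneg_right (NNReal.coe_nonneg _))⟩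
  · obtain ⟨s, hs⟩ := hy i
    exact (hline i s).of_dist hs

/-- Points of the boundary seen from `x` by Morse geodesics form pairs of controlled gauge. -/
theorem NearPair.morsePair (hX : IsGeodesicSpace X) {N : Gauge} {K : ℝ≥0} {x : X}
    {a a' b b' : MorseBoundary p} (ha : NearPair N K x a' a) (hb : NearPair N K x b' b)
    (hab : a ≠ b) : MorsePair (joinGauge N K) a b := by
  obtain ⟨ma, α, hα, hxα⟩ := ha
  obtain ⟨mb, β, hβ, hxβ⟩ := hb
  exact ⟨hab, fun γ hγ =>
    hα.isMorseLine_of_common_point hX hβ (ma.2 α hα) (mb.2 β hβ) hxα hxβ hγ⟩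

/-- A point near a side of an ideal triangle is near a second side. -/
theorem NearPair.near_or_near [ProperSpace X] (hX : IsGeodesicSpace X) {N : Gauge} {K : ℝ} {x : X}
    {a b c : MorseBoundary p} (hab : NearPair N K x a b) (hca : c ≠ a → MorsePair N c a)
    (hcb : c ≠ b → MorsePair N c b) :
    NearPair N (K + triangleConst N) x c a ∨ NearPair N (K + triangleConst N) x c b := by
  have hK : K ≤ K + triangleConst N := le_add_of_nonneg_right (NNReal.coe_nonneg _)
  by_cases h1 : c = a
  · subst h1; exact Or.inr (hab.mono le_rfl hK)
  by_cases h2 : c = b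
  · subst h2; exact Or.inl (hab.symm.mono le_rfl hK)
  obtain ⟨α, hα⟩ := exists_isGeodesicFromTo hX h1
  obtain ⟨β, hβ⟩ := exists_isGeodesicFromTo hX (Ne.symm h2)
  obtain ⟨-, γ, hγ, _, ⟨t, rfl⟩, hx⟩ := hab
  rcases isNear_or_isNear hX hγ hβ hα ((hca h1).2 α hα) ((hcb h2).symm.2 β hβ) t with h | h
  · exact Or.inl ⟨hca h1, α, hα, h.of_dist hx⟩
  · exact Or.inr (NearPair.symm ⟨(hcb h2).symm, β, hβ, h.of_dist hx⟩)

end Centers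

/-! ### Images of centers under quasi-möbius maps -/

section Transfer

variable {X Y : Type*} [MetricSpace X] [MetricSpace Y] [ProperSpace Y]
  {p : X} {r : Y} {h : MorseBoundary p → MorseBoundary r}

/-- `x` is near geodesics joining the three points. -/
def NearTriple (N : Gauge) (K : ℝ) (x : X) (a b c : MorseBoundary p) : Prop :=
  NearPair N K x a b ∧ NearPair N K x b c ∧ NearPair N K x c a

theorem NearTriple.rotate {N : Gauge} {K : ℝ} {x : X} {a b c : MorseBoundary p}
    (h : NearTriple N K x a b c) : NearTriple N K x b c a := ⟨h.2.1, h.2.2, h.1⟩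

theorem NearTriple.swap {N : Gauge} {K : ℝ} {x : X} {a b c : MorseBoundary p}
    (h : NearTriple N K x a b c) : NearTriple N K x b a c := ⟨h.1.symm, h.2.2.symm, h.2.1.symm⟩

theorem NearTriple.map_centers_nonempty (hY : IsGeodesicSpace Y) {N N' : Gauge}
    (hh : MapsTuples h 2 N N') {K K' : ℝ} (hK' : IsInternalConstant r N' K') {x : X}
    {a b c : MorseBoundary p} (hx : NearTriple N K x a b c) :
    ∃ y, NearTriple N' K' y (h a) (h b) (h c) := by
  obtain ⟨y, hy⟩ := centers_nonempty hY hK' (hh.of_two 3 _ (mem_centers_vec.2 hx).1)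
  exact ⟨y, mem_centers_iff.1 hy⟩

/-- When one vertex of a triple is changed without moving the center, the centers of the image
under a quasi-möbius map move by a bounded amount. -/
theorem exists_dist_le_of_replace_vertex (hX : IsGeodesicSpace X) (hY : IsGeodesicSpace Y)
    {κX κY : Gauge → ℝ} (hκY : IsInternalConstantChoice r κY) (hqm : IsQuasiMobius κX κY h)
    {N N' : Gauge} (hh : MapsTuples h 2 N N') (K K' : ℝ) :
    ∃ E : ℝ, ∀ (x : X) (y y' : Y) (a a' b c : MorseBoundary p), NearTriple N K x a b c →
      NearTriple N K x a' b c → (a ≠ a' → MorsePair N a a') →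
      NearTriple N' K' y (h a) (h b) (h c) → NearTriple N' K' y' (h a') (h b) (h c) →
      dist y y' ≤ E := by
  obtain ⟨ψ, -, hψ, hcr⟩ := hqm N N' hh
  obtain ⟨D, hD⟩ := exists_dist_centers_le hX p N (max K (κX N))
  obtain ⟨D', hD'⟩ := exists_dist_centers_le hY r N' (max K' (κY N'))
  have hint := hκY N' (exists_isInternalConstant hY r N')
  refine ⟨max D' (D' + ψ (2 * D).toNNReal + D'), fun x y y' a a' b c hx hx' haa hy hy' => ?_⟩
  -- Cross-ratios are controlled only for four distinct points, so `a = a'` is settled by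
  -- boundedness of centers.
  by_cases heq : a = a'
  · subst heq
    exact (hD' ![h a, h b, h c] y (centers_mono le_rfl (le_max_left _ _) (mem_centers_vec.2 hy)) y'
      (centers_mono le_rfl (le_max_left _ _) (mem_centers_vec.2 hy'))).trans (le_max_left _ _)
  refine le_trans ?_ (le_max_right _ _)
  have hm := haa heq
  -- In this order the cross-ratio compares exactly the triples `(b, a, c)` and `(b, a', c)`.
  have htup : ![b, a, c, a'] ∈ morseTuples p 4 N := mem_morseTuples_iff.2 fun i j hij => by
    fin_cases i <;> fin_cases j <;>
      first
      | exact absurd rfl hij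
      | exact hx.1.1
      | exact hx.1.1.symm
      | exact hx.2.1.1
      | exact hx.2.1.1.symm
      | exact hx.2.2.1
      | exact hx.2.2.1.symm
      | exact hx'.1.1
      | exact hx'.1.1.symm
      | exact hx'.2.2.1
      | exact hx'.2.2.1.symm
      | exact hm
      | exact hm.symm
  have hcrX : crossRatio p κX N b a c a' ≤ (2 * D).toNNReal := by
    have hbound : ∀ z ∈ centers p N (κX N) ![b, a, c] ∪ centers p N (κX N) ![b, a', c],
        dist z x ≤ D := by
      rintro z (hz | hz)
      · exact hD _ z (centers_mono le_rfl (le_max_right _ _) hz) x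
          (centers_mono le_rfl (le_max_left _ _) (mem_centers_vec.2 hx.swap))
      · exact hD _ z (centers_mono le_rfl (le_max_right _ _) hz) x
          (centers_mono le_rfl (le_max_left _ _) (mem_centers_vec.2 hx'.swap))
    have hD0 : 0 ≤ D := dist_nonneg.trans (hD ![a, b, c] x
      (centers_mono le_rfl (le_max_left _ _) (mem_centers_vec.2 hx)) x
      (centers_mono le_rfl (le_max_left _ _) (mem_centers_vec.2 hx)))
    rw [← NNReal.coe_le_coe, Real.coe_toNNReal _ (by linarith)]
    refine Metric.diam_le_of_forall_dist_le (by linarith) fun z hz z' hz' => ?_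
    have := dist_triangle_right z z' x
    linarith [hbound z hz, hbound z' hz']
  obtain ⟨w, hw⟩ := hx.swap.map_centers_nonempty hY hh hint
  obtain ⟨w', hw'⟩ := hx'.swap.map_centers_nonempty hY hh hint
  have hd1 := hD' ![h b, h a, h c] y (centers_mono le_rfl (le_max_left _ _)
    (mem_centers_vec.2 hy.swap)) w (centers_mono le_rfl (le_max_right _ _) (mem_centers_vec.2 hw))
  have hd2 := hD' ![h b, h a', h c] w' (centers_mono le_rfl (le_max_right _ _)
    (mem_centers_vec.2 hw')) y' (centers_mono le_rfl (le_max_left _ _)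
    (mem_centers_vec.2 hy'.swap))
  -- Boundedness is essential: `Metric.diam` is `0` on unbounded sets and would then bound no
  -- distance.
  have hbdd : ∀ v, Bornology.IsBounded (centers r N' (κY N') v) := fun v =>
    Metric.isBounded_iff.2 ⟨D', fun z hz z' hz' =>
      hD' v z (centers_mono le_rfl (le_max_right _ _) hz) z'
        (centers_mono le_rfl (le_max_right _ _) hz')⟩
  have hd3 : dist w w' ≤ crossRatio r κY N' (h b) (h a) (h c) (h a') :=
    Metric.dist_le_diam_of_mem ((hbdd _).union (hbdd _)) (Or.inl (mem_centers_vec.2 hw))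
      (Or.inr (mem_centers_vec.2 hw'))
  have hd4 : (crossRatio r κY N' (h b) (h a) (h c) (h a') : ℝ) ≤ ψ (2 * D).toNNReal :=
    NNReal.coe_le_coe.2 ((hcr b a c a' htup).trans (hψ hcrX))
  have := dist_triangle4 y w w' y'
  linarith

/-- When two triples have nearby centers, so have their images under a quasi-möbius map. -/
theorem exists_dist_map_centers_le [ProperSpace X] (hX : IsGeodesicSpace X)
    (hY : IsGeodesicSpace Y) {κX κY : Gauge → ℝ} (hκY : IsInternalConstantChoice r κY)
    (hst : IsTwoStable h) (hqm : IsQuasiMobius κX κY h) (N N' : Gauge) (K K' R : ℝ) :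
    ∃ E : ℝ, ∀ (v v' : Fin 3 → MorseBoundary p), ∀ x ∈ centers p N K v, ∀ x' ∈ centers p N K v',
      dist x x' ≤ R → ∀ y ∈ centers r N' K' (h ∘ v), ∀ y' ∈ centers r N' K' (h ∘ v'),
      dist y y' ≤ E := by
  set K₀ : ℝ≥0 := (|R| + |K|).toNNReal with hK₀
  have hK₀' : (K₀ : ℝ) = |R| + |K| := Real.coe_toNNReal _ (by positivity)
  -- This gauge covers the given pairs and all pairs mixing vertices of both triples, as all are
  -- seen from `x`.
  set M := N ⊔ joinGauge N K₀ with hM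
  obtain ⟨M', hM'⟩ := hst M
  have hh : MapsTuples h 2 M (M' ⊔ N') := fun v hv => morseTuples_mono le_sup_left (hM' v hv)
  -- The thinness loss occurs only once: every mixed pair is obtained directly from original pairs.
  set K₁ : ℝ := K₀ + triangleConst M with hK₁
  set K₂ : ℝ := max K' (κY (M' ⊔ N')) with hK₂
  have hint := hκY (M' ⊔ N') (exists_isInternalConstant hY r (M' ⊔ N'))
  obtain ⟨E, hE⟩ := exists_dist_le_of_replace_vertex hX hY hκY hqm hh K₁ K₂
  refine ⟨E + E + E, fun v v' x hx x' hx' hd y hy y' hy' => ?_⟩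
  replace hx : x ∈ centers p N K₀ v :=
    centers_mono le_rfl (by rw [hK₀']; linarith [abs_nonneg R, le_abs_self K]) hx
  replace hx' : x ∈ centers p N K₀ v' :=
    centers_mono le_rfl (by rw [hK₀']; linarith [le_abs_self R, le_abs_self K])
      (mem_centers_of_dist_le hx' hd)
  rw [mem_centers_iff] at hx hx'
  set a := v 0
  set b := v 1
  set c := v 2
  set u := v' 0
  set u' := v' 1
  set u'' := v' 2
  have hy : NearTriple (M' ⊔ N') K₂ y (h a) (h b) (h c) :=
    mem_centers_iff.1 (centers_mono le_sup_right (le_max_left _ _) hy)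
  have hy' : NearTriple (M' ⊔ N') K₂ y' (h u) (h u') (h u'') :=
    mem_centers_iff.1 (centers_mono le_sup_right (le_max_left _ _) hy')
  have seen : ∀ {z₁ z₁' z₂ z₂' : MorseBoundary p}, NearPair N K₀ x z₁' z₁ → NearPair N K₀ x z₂' z₂ →
      z₁ ≠ z₂ → MorsePair M z₁ z₂ := fun h1 h2 h3 => (h1.morsePair hX h2 h3).mono le_sup_right
  have hK01 : (K₀ : ℝ) ≤ K₁ := le_add_of_nonneg_right (NNReal.coe_nonneg _)
  have up : ∀ {z₁ z₂ : MorseBoundary p}, NearPair N K₀ x z₁ z₂ → NearPair M K₁ x z₁ z₂ :=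
    fun h1 => h1.mono le_sup_left hK01
  have alt : ∀ {z z' z₁ z₂ : MorseBoundary p}, NearPair N K₀ x z' z → NearPair N K₀ x z₁ z₂ →
      NearPair M K₁ x z z₁ ∨ NearPair M K₁ x z z₂ := fun h1 h2 =>
    (h2.mono le_sup_left le_rfl).near_or_near hX (fun h3 => seen h1 h2.symm h3) fun h3 => seen h1 h2 h3
  -- The last two steps: from `u, b, c` to `u, u', c` and on to `u, u', u''`.
  have finish : ∀ {b c b' c' : MorseBoundary p} {y₁ : Y}, NearPair N K₀ x b c →
      NearPair N K₀ x b' b → NearPair N K₀ x c' c → NearTriple M K₁ x u b c →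
      NearTriple (M' ⊔ N') K₂ y₁ (h u) (h b) (h c) → dist y₁ y' ≤ E + E := by
    have aux : ∀ {b c b' c' : MorseBoundary p} {y₁ : Y}, NearPair N K₀ x b' b →
        NearPair N K₀ x c' c → NearTriple M K₁ x u b c → NearPair M K₁ x u' c →
        NearTriple (M' ⊔ N') K₂ y₁ (h u) (h b) (h c) → dist y₁ y' ≤ E + E := by
      intro b c b' c' y₁ hb hc ht hu'c hy₁
      have ht' : NearTriple M K₁ x u u' c := ⟨up hx'.1, hu'c, ht.2.2⟩
      obtain ⟨y₂, hy₂⟩ := ht'.map_centers_nonempty hY hh hint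
      have hy₂ : NearTriple (M' ⊔ N') K₂ y₂ (h u) (h u') (h c) :=
        ⟨hy₂.1.mono le_rfl (le_max_right _ _), hy₂.2.1.mono le_rfl (le_max_right _ _),
          hy₂.2.2.mono le_rfl (le_max_right _ _)⟩
      have d1 := hE x y₁ y₂ b u' c u ht.rotate ht'.rotate (fun h3 => seen hb hx'.1 h3) hy₁.rotate
        hy₂.rotate
      have ht'' : NearTriple M K₁ x u u' u'' := ⟨up hx'.1, up hx'.2.1, up hx'.2.2⟩
      have d2 := hE x y₂ y' c u'' u u' ht'.rotate.rotate ht''.rotate.rotate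
        (fun h3 => seen hc hx'.2.1 h3) hy₂.rotate.rotate hy'.rotate.rotate
      linarith [dist_triangle y₁ y₂ y']
    intro b c b' c' y₁ hbc hb hc ht hy₁
    rcases alt hx'.1 hbc with h1 | h1
    · exact aux hc hb ht.swap.rotate h1 hy₁.swap.rotate
    · exact aux hb hc ht h1 hy₁
  have start : ∀ {a b c a' b' c' : MorseBoundary p}, NearPair N K₀ x b c → NearPair N K₀ x a' a →
      NearPair N K₀ x b' b → NearPair N K₀ x c' c → NearTriple M K₁ x a b c →
      NearTriple (M' ⊔ N') K₂ y (h a) (h b) (h c) → NearPair M K₁ x u b → NearPair M K₁ x u c →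
      dist y y' ≤ E + E + E := by
    intro a b c a' b' c' hbc ha hb hc ht hy hub huc
    have ht' : NearTriple M K₁ x u b c := ⟨hub, up hbc, huc.symm⟩
    obtain ⟨y₁, hy₁⟩ := ht'.map_centers_nonempty hY hh hint
    have hy₁ : NearTriple (M' ⊔ N') K₂ y₁ (h u) (h b) (h c) :=
      ⟨hy₁.1.mono le_rfl (le_max_right _ _), hy₁.2.1.mono le_rfl (le_max_right _ _),
        hy₁.2.2.mono le_rfl (le_max_right _ _)⟩
    have d1 := hE x y y₁ a u b c ht ht' (fun h3 => seen ha hx'.2.2 h3) hy hy₁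
    linarith [dist_triangle y y₁ y', finish hbc hb hc ht' hy₁]
  have ht : NearTriple M K₁ x a b c := ⟨up hx.1, up hx.2.1, up hx.2.2⟩
  -- On each side of `(a, b, c)` the point `u` can be paired with one of the ends. So it pairs with
  -- at least two vertices, and the remaining one is exchanged for `u`.
  have hab := alt hx'.2.2 hx.1
  have hbc := alt hx'.2.2 hx.2.1
  have hca := alt hx'.2.2 hx.2.2
  by_cases hub : NearPair M K₁ x u b
  · by_cases huc : NearPair M K₁ x u c
    · exact start hx.2.1 hx.2.2 hx.1 hx.2.1 ht hy hub huc
    · exact start hx.1 hx.2.1 hx.2.2 hx.1 ht.rotate.rotate hy.rotate.rotate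
        (hca.resolve_left huc) hub
  · exact start hx.2.2 hx.1 hx.2.1 hx.2.2 ht.rotate hy.rotate (hbc.resolve_left hub)
      (hab.resolve_right hub)

end Transfer

/-! ### Criteria for quasi-isometries -/

section QuasiIsometry

variable {X Y : Type*} [MetricSpace X] [MetricSpace Y]

/-- On a geodesic space, a map that is bounded on balls of radius `1` is coarsely Lipschitz. -/
theorem IsGeodesicSpace.dist_map_le (hX : IsGeodesicSpace X) {f : X → Y} {E : ℝ}
    (hf : ∀ x x', dist x x' ≤ 1 → dist (f x) (f x') ≤ E) (x x' : X) :
    dist (f x) (f x') ≤ E * dist x x' + E := by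
  have hE : 0 ≤ E := dist_nonneg.trans (hf x x (by simp))
  have step : ∀ (n : ℕ) (x x' : X), dist x x' ≤ n → dist (f x) (f x') ≤ E * n := by
    intro n
    induction n with
    | zero =>
      intro x x' h
      have : x = x' := dist_le_zero.1 (by simpa using h)
      simp [this]
    | succ n ih =>
      intro x x' h
      by_cases hn : dist x x' ≤ n
      · refine (ih x x' hn).trans ?_
        push_cast
        linarith
      push Not at hn
      obtain ⟨γ, h0, h1, hγ⟩ := hX x x'
      have hn0 : (0 : ℝ) ≤ n := Nat.cast_nonneg n
      have hmem : (n : ℝ) ∈ Set.Icc 0 (dist x x') := ⟨hn0, hn.le⟩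
      have d1 : dist x (γ n) ≤ n := by
        rw [← h0, hγ 0 ⟨le_rfl, dist_nonneg⟩ n hmem, zero_sub, abs_neg, abs_of_nonneg hn0]
      have d2 : dist (γ n) x' ≤ 1 := by
        have := hγ n hmem (dist x x') ⟨dist_nonneg, le_rfl⟩
        rw [h1, abs_sub_comm, abs_of_nonneg (by linarith)] at this
        push_cast at h
        linarith
      have e1 := ih x _ d1
      have e2 := hf _ _ d2
      push_cast
      linarith [dist_triangle (f x) (f (γ n)) (f x')]
  refine (step _ x x' (Nat.le_ceil _)).trans ?_
  have := (Nat.ceil_lt_add_one (@dist_nonneg _ _ x x')).le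
  nlinarith

/-- Coarsely Lipschitz maps that are coarsely inverse to each other are quasi-isometries. -/
theorem IsQuasiIsometry.of_coarse_inverse (hX : IsGeodesicSpace X) (hY : IsGeodesicSpace Y)
    {f : X → Y} {g : Y → X} {E : ℝ} (hf : ∀ x x', dist x x' ≤ 1 → dist (f x) (f x') ≤ E)
    (hg : ∀ y y', dist y y' ≤ 1 → dist (g y) (g y') ≤ E) (hgf : ∀ x, dist (g (f x)) x ≤ E)
    (hfg : ∀ y, dist (f (g y)) y ≤ E) : IsQuasiIsometry f := by
  rcases isEmpty_or_nonempty X with hemp | ⟨⟨x₀⟩⟩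
  · exact ⟨⟨1, 0, le_rfl, le_rfl, fun x => hemp.elim x⟩, g, |E|, abs_nonneg _,
      fun x => hemp.elim x, fun y => (hfg y).trans (le_abs_self E)⟩
  have hE : 0 ≤ E := dist_nonneg.trans (hgf x₀)
  -- The lower bound is the Lipschitz bound for `g`: its additive `E`, plus `E` for each of `g (f
  -- x)` and `g (f x')`, gives `3 * E`.
  refine ⟨⟨E + 1, 3 * E, by linarith, by linarith, fun x x' => ⟨?_, ?_⟩⟩, g, E, hE, hgf, hfg⟩
  · have e1 := hY.dist_map_le hg (f x) (f x')
    have e2 := dist_triangle4 x (g (f x)) (g (f x')) x'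
    rw [dist_comm x (g (f x))] at e2
    have e3 := hgf x
    have e4 := hgf x'
    have hd := @dist_nonneg _ _ (f x) (f x')
    rw [sub_le_iff_le_add, one_div, inv_mul_le_iff₀ (by linarith)]
    nlinarith
  · have e1 := hX.dist_map_le hf x x'
    have hd := @dist_nonneg _ _ x x'
    nlinarith

/-- A map at finite distance from a quasi-isometry is a quasi-isometry. -/
theorem IsQuasiIsometry.of_dist_le {f f' : X → Y} (hf : IsQuasiIsometry f) {D : ℝ} (hD : 0 ≤ D)
    (hff : ∀ x, dist (f' x) (f x) ≤ D) : IsQuasiIsometry f' := by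
  obtain ⟨⟨l, e, hl, he, h⟩, g, D', hD', hgf, hfg⟩ := hf
  refine ⟨⟨l, e + 2 * D, hl, by linarith, fun x x' => ?_⟩, g, D' + D + l * (D' + D + e),
    by positivity, fun x => ?_, fun y => ?_⟩
  · have e1 := dist_triangle4 (f' x) (f x) (f x') (f' x')
    have e2 := dist_triangle4 (f x) (f' x) (f' x') (f x')
    rw [dist_comm (f x') (f' x')] at e1
    rw [dist_comm (f x) (f' x)] at e2
    have := hff x
    have := hff x'
    have := h x x'
    constructor <;> linarith
  · have e1 := (h (g (f' x)) x).1
    have e2 := dist_triangle (f (g (f' x))) (f' x) (f x)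
    have e3 := hfg (f' x)
    have e4 := hff x
    have e5 : 1 / l * dist (g (f' x)) x ≤ D' + D + e := by linarith
    rw [one_div, inv_mul_le_iff₀ (by linarith)] at e5
    linarith
  · have := dist_triangle (f' (g y)) (f (g y)) y
    have := hff (g y)
    have := hfg y
    have : 0 ≤ l * (D' + D + e) := by positivity
    linarith

end QuasiIsometry

/-! ### Center maps and the theorem -/

section CenterMaps

variable {X Y : Type*} [MetricSpace X] [MetricSpace Y] {p : X} {r : Y}

theorem IsMorseCenterWith.mono {N N' : Gauge} (hN : N ≤ N') (h : IsMorseCenterWith p N) :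
    IsMorseCenterWith p N' := by
  obtain ⟨K, hK, h⟩ := h
  refine ⟨K, hK, Set.eq_univ_of_univ_subset ?_⟩
  rw [← h]
  exact Set.iUnion₂_subset fun v hv => (centers_mono hN le_rfl).trans
    (Set.subset_iUnion₂ (s := fun v (_ : v ∈ morseTuples p 3 N') => centers p N' K v) v
      (morseTuples_mono hN hv))

theorem IsMorseCenterWith.exists_mem {N : Gauge} (h : IsMorseCenterWith p N) :
    ∃ K : ℝ, 0 < K ∧ ∀ x, ∃ v, x ∈ centers p N K v := by
  obtain ⟨K, hK, h⟩ := h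
  refine ⟨K, hK, fun x => ?_⟩
  have hx : x ∈ ⋃ v ∈ morseTuples p 3 N, centers p N K v := h ▸ Set.mem_univ x
  obtain ⟨v, -, hv⟩ := Set.mem_iUnion₂.1 hx
  exact ⟨v, hv⟩

theorem exists_admissibleGauges {h : MorseBoundary p → MorseBoundary r} (hX : IsMorseCenter p)
    (hY : IsMorseCenter r) (hst : IsTwoStable h) : ∃ N Nh : Gauge, AdmissibleGauges h N Nh := by
  obtain ⟨N₁, h₁⟩ := hX
  obtain ⟨N₂, h₂⟩ := hY
  obtain ⟨N', hN'⟩ := hst (N₁ ⊔ N₂)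
  exact ⟨N₁ ⊔ N₂, (N₁ ⊔ N₂) ⊔ N', h₁.mono le_sup_left, h₂.mono le_sup_right, le_sup_left,
    fun v hv => morseTuples_mono le_sup_right (hN'.of_two 3 v hv)⟩

/-- A map that sends every point `x` to a center of the image of a triple of which `x` is a center
is a quasi-isometry. -/
theorem isQuasiIsometry_of_centers [ProperSpace X] [ProperSpace Y]
    (hX : IsGeodesicSpace X) (hY : IsGeodesicSpace Y)
    {κX κY : Gauge → ℝ} (hκX : IsInternalConstantChoice p κX)
    (hκY : IsInternalConstantChoice r κY) (h : MorseBoundary p ≃ MorseBoundary r)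
    (hst : IsTwoStable h) (hst' : IsTwoStable h.symm) (hqm : IsQuasiMobius κX κY h)
    (hqm' : IsQuasiMobius κY κX h.symm) {N Nh : Gauge} (hN : N ≤ Nh) {K : ℝ}
    (hK : ∀ y, ∃ v, y ∈ centers r N K v) {f : X → Y}
    (hf : ∀ x, ∃ v, x ∈ centers p N K v ∧ f x ∈ centers r Nh K (h ∘ v)) : IsQuasiIsometry f := by
  obtain ⟨Ng, hNg⟩ := hst' N
  set K' := max K (κX Ng)
  have hKK' : K ≤ K' := le_max_left _ _
  have hint := hκX Ng (exists_isInternalConstant hX p Ng)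
  have hg : ∀ y, ∃ x, ∃ v, y ∈ centers r N K v ∧ x ∈ centers p Ng K' (h.symm ∘ v) := by
    intro y
    obtain ⟨v, hv⟩ := hK y
    obtain ⟨x, hx⟩ := centers_nonempty hX hint (hNg.of_two 3 v hv.1)
    exact ⟨x, v, hv, centers_mono le_rfl (le_max_right _ _) hx⟩
  choose g hg using hg
  set M := Nh ⊔ Ng
  have hNM : N ≤ M := hN.trans le_sup_left
  -- Radius `1` gives the coarse Lipschitz bounds; the same estimates at distance `0` give the
  -- coarse inverse relations.
  obtain ⟨E₁, h₁⟩ := exists_dist_map_centers_le hX hY hκY hst hqm M M K' K' 1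
  obtain ⟨E₂, h₂⟩ := exists_dist_map_centers_le hY hX hκX hst' hqm' M M K' K' 1
  have m₁ : E₁ ≤ max E₁ E₂ := le_max_left _ _
  have m₂ : E₂ ≤ max E₁ E₂ := le_max_right _ _
  have hcancel : ∀ v : Fin 3 → MorseBoundary p, h.symm ∘ h ∘ v = v := fun v => by ext1 i; simp
  have hcancel' : ∀ v : Fin 3 → MorseBoundary r, h ∘ h.symm ∘ v = v := fun v => by ext1 i; simp
  refine IsQuasiIsometry.of_coarse_inverse hX hY (E := max E₁ E₂) (g := g) (fun x x' hd => ?_)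
    (fun y y' hd => ?_) (fun x => ?_) fun y => ?_
  · obtain ⟨v, hv, hv'⟩ := hf x
    obtain ⟨w, hw, hw'⟩ := hf x'
    exact (h₁ v w x (centers_mono hNM hKK' hv) x' (centers_mono hNM hKK' hw) hd _
      (centers_mono le_sup_left hKK' hv') _ (centers_mono le_sup_left hKK' hw')).trans m₁
  · obtain ⟨v, hv, hv'⟩ := hg y
    obtain ⟨w, hw, hw'⟩ := hg y'
    exact (h₂ v w y (centers_mono hNM hKK' hv) y' (centers_mono hNM hKK' hw) hd _
      (centers_mono le_sup_right le_rfl hv') _ (centers_mono le_sup_right le_rfl hw')).trans m₂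
  · obtain ⟨v, hv, hv'⟩ := hf x
    obtain ⟨w, hw, hw'⟩ := hg (f x)
    -- `f x` is a center of both `w` and `h ∘ v`; pulled back by `h.symm`, these triples have the
    -- centers `g (f x)` and `x`.
    exact (h₂ w (h ∘ v) _ (centers_mono hNM hKK' hw) _ (centers_mono le_sup_left hKK' hv')
      (by simp) _ (centers_mono le_sup_right le_rfl hw') _
      (by rw [hcancel]; exact centers_mono hNM hKK' hv)).trans m₂
  · obtain ⟨w, hw, hw'⟩ := hg y
    obtain ⟨v, hv, hv'⟩ := hf (g y)
    exact (h₁ v (h.symm ∘ w) _ (centers_mono hNM hKK' hv) _ (centers_mono le_sup_right le_rfl hw')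
      (by simp) _ (centers_mono le_sup_left hKK' hv') _
      (by rw [hcancel']; exact centers_mono hNM hKK' hw)).trans m₁

end CenterMaps

end MorseBdry

theorem theorem4p2 {X : Type*} {Y : Type*} [MetricSpace X] [MetricSpace Y]
    [ProperSpace X] [ProperSpace Y]
    (hX : MorseBdry.IsGeodesicSpace X) (hY : MorseBdry.IsGeodesicSpace Y)
    (p : X) (r : Y)
    (κX κY : MorseBdry.Gauge → ℝ)
    (hκX : MorseBdry.IsInternalConstantChoice p κX)
    (hκY : MorseBdry.IsInternalConstantChoice r κY)
    (hcX : MorseBdry.IsMorseCenter p) (hcY : MorseBdry.IsMorseCenter r)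
    (hsX : MorseBdry.SmallCrossRatio p κX) (hsY : MorseBdry.SmallCrossRatio r κY)
    (h : MorseBdry.MorseBoundary p ≃ₜ MorseBdry.MorseBoundary r)
    (hst : MorseBdry.IsTwoStable h) (hst' : MorseBdry.IsTwoStable h.symm)
    (hqm : MorseBdry.IsQuasiMobius κX κY h) (hqm' : MorseBdry.IsQuasiMobius κY κX h.symm) :
    (∃ N Nh : MorseBdry.Gauge, MorseBdry.AdmissibleGauges h N Nh) ∧
    ∀ N Nh : MorseBdry.Gauge, MorseBdry.AdmissibleGauges h N Nh →
      ∃ K₁ : ℝ, 0 < K₁ ∧ ∀ K : ℝ, K₁ ≤ K →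
        (∃ f : X → Y, MorseBdry.IsCenterMap h N Nh K f) ∧
        ∀ f : X → Y, MorseBdry.IsCenterMap h N Nh K f → MorseBdry.IsQuasiIsometry f := by
  classical
  refine ⟨MorseBdry.exists_admissibleGauges hcX hcY hst, ?_⟩
  rintro N Nh ⟨hNX, hNY, hN, hmap⟩
  obtain ⟨KX, hKX, hcentX⟩ := hNX.exists_mem
  obtain ⟨KY, hKY, hcentY⟩ := hNY.exists_mem
  have hint := hκY Nh (MorseBdry.exists_isInternalConstant hY r Nh)
  -- `KX` and `KY` make all points of `X` and `Y` centers; `κY Nh` makes image triples have centers.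
  refine ⟨max (max KX KY) (κY Nh), lt_max_of_lt_left (lt_max_of_lt_left hKX), fun K hK => ?_⟩
  have hX' : KX ≤ K := ((le_max_left _ _).trans (le_max_left _ _)).trans hK
  have hY' : KY ≤ K := ((le_max_right _ _).trans (le_max_left _ _)).trans hK
  have hκ : κY Nh ≤ K := (le_max_right _ _).trans hK
  have hex : ∀ x, ∃ y, ∃ v, x ∈ MorseBdry.centers p N K v ∧
      y ∈ MorseBdry.centers r Nh K (h ∘ v) := by
    intro x
    obtain ⟨v, hv⟩ := hcentX x
    obtain ⟨y, hy⟩ := MorseBdry.centers_nonempty hY hint (hmap v hv.1)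
    exact ⟨y, v, MorseBdry.centers_mono le_rfl hX' hv, MorseBdry.centers_mono le_rfl hκ hy⟩
  choose f₀ hf₀ using hex
  refine ⟨⟨Function.update f₀ p r, by simp, fun x hx => ?_⟩, fun f hf => ?_⟩
  · rw [Function.update_of_ne hx]
    exact hf₀ x
  -- The prescribed value at `p` need not be a center of the image of a triple centered at `p`.
  -- Changing it moves `f` at one point only.
  · refine MorseBdry.IsQuasiIsometry.of_dist_le (f := Function.update f p (f₀ p))
      (D := dist (f p) (f₀ p)) ?_ dist_nonneg fun x => ?_
    · refine MorseBdry.isQuasiIsometry_of_centers hX hY hκX hκY h.toEquiv hst hst' hqm hqm' hN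
        (fun y => (hcentY y).imp fun v hv => MorseBdry.centers_mono le_rfl hY' hv) fun x => ?_
      by_cases hx : x = p
      · subst hx
        rw [Function.update_self]
        exact hf₀ x
      · rw [Function.update_of_ne hx]
        exact hf.2 x hx
    · by_cases hx : x = p
      · subst hx; simp
      · simp [hx]
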